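/- Let $M$ be a paracompact (Hausdorff) smooth manifold of dimension $n$ and let $A$ be a Weil algebra, i.e. a finite-dimensional commutative unital local $\mathbb R$-algebra whose maximal ideal $\mathfrak m$ has codimension $1$. Let $M^A$ be the manifold of near points of kind $A$: its points are the algebra morphisms $\xi:C^\infty(M)\to A$ for which there is $x\in M$ with $\xi(f)-f(x)\in\mathfrak m$ for all $f\in C^\infty(M)$, and a chart $(U,x_1,\dots,x_n)$ of $M$ induces the chart $\xi\mapsto(\xi(x_1),\dots,\xi(x_n))\in A^n$ on the set of near points over $U$. Let $C^\infty(M^A,A)$ be the $A$-algebra of smooth $A$-valued functions on $M^A$, and for $f\in C^\infty(M)$ let $f^A\in C^\infty(M^A,A)$, $f^A(\xi)=\xi(f)$. A vector field on $M$ is a derivation of $C^\infty(M)$. A vector field on $M^A$ is a derivation of $C^\infty(M^A)$, extended $A$-linearly to $C^\infty(M^A,A)$; equivalently, an $A$-linear derivation of $C^\infty(M^A,A)$ which maps the real-valued functions $C^\infty(M^A)$ into themselves. For every vector field $\theta$ on $M$ there is exactly one vector field $\theta^A$ on $M^A$, the prolongation of $\theta$, such that $\theta^A(f^A)=(\theta(f))^A$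 for all $f\in C^\infty(M)$. Let $\{\cdot,\cdot\}$ be a Poisson bracket on $M$, put $\mathrm{ad}(f)=\{f,\cdot\}$, and let $d_{\mathrm{ad}}(f)$ be the cochain $g\mapsto\{f,g\}$; a vector field $\theta$ on $M$ is globally Hamiltonian if $\theta=d_{\mathrm{ad}}(f)$ for some $f\in C^\infty(M)$. For $\varphi\in C^\infty(M^A,A)$ let $\widetilde\tau_\varphi$ denote the vector field on $M^A$, if it exists, with $$\widetilde\tau_\varphi(f^A)=-[\mathrm{ad}(f)]^A(\varphi)\qquad\text{for all } f\in C^\infty(M),$$ and let $\widetilde{d_A}(\varphi)$ be the cochain $\psi\mapsto\{\varphi,\psi\}_A:=\widetilde\tau_\varphi(\psi)$. A vector field $X$ on $M^A$ is globally Hamiltonian if there is $\varphi\in C^\infty(M^A,A)$ for which $\widetilde\tau_\varphi$ exists and $X=\widetilde{d_A}(\varphi)$. Proposition. Let $\theta$ be a vector field on the Poisson manifold $M$. If $\theta=d_{\mathrm{ad}}(f)$ with $f\in C^\infty(M)$, then $\theta^A=[\mathrm{ad}(f)]^A$, that is, $\theta^A(g^A)=\{f,g\}^A$ for all $g\in C^\infty(M)$;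 the vector field $\widetilde\tau_{f^A}$ exists and is unique, and $\theta^A=\widetilde{d_A}(f^A)$. In particular, if $\theta$ is globally Hamiltonian, then $\theta^A$ is globally Hamiltonian. -/

import Mathlib

open scoped ContDiff Manifold Topology

/-- Weil algebras: finite-dimensional commutative local real algebras whose maximal ideal `𝔪` has
codimension `1`. -/
class IsWeilAlgebra (A : Type*) [CommRing A] [Algebra ℝ A] : Prop extends
    Module.Finite ℝ A, IsLocalRing A where
  finrank_residue : Module.finrank ℝ (A ⧸ IsLocalRing.maximalIdeal A) = 1

namespace WeilAlgebra

section Algebra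

variable (A : Type*) [CommRing A] [Algebra ℝ A] [IsWeilAlgebra A]

theorem bijective_ofId :
    Function.Bijective (Algebra.ofId ℝ (A ⧸ IsLocalRing.maximalIdeal A)) :=
  Algebra.finrank_eq_one_iff_bijective_algebraMap.1 IsWeilAlgebra.finrank_residue

/-- The augmentation `A = ℝ ⊕ 𝔪 → ℝ`. -/
noncomputable def realPart : A →ₐ[ℝ] ℝ :=
  ((AlgEquiv.ofBijective _ (bijective_ofId A)).symm :
    (A ⧸ IsLocalRing.maximalIdeal A) →ₐ[ℝ] ℝ).comp
    (Ideal.Quotient.mkₐ ℝ (IsLocalRing.maximalIdeal A))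

variable {A}

theorem realPart_eq_zero_iff (a : A) : realPart A a = 0 ↔ a ∈ IsLocalRing.maximalIdeal A := by
  simp [realPart, Ideal.Quotient.eq_zero_iff_mem]

theorem realPart_algebraMap (r : ℝ) : realPart A (algebraMap ℝ A r) = r :=
  (realPart A).commutes r

theorem sub_realPart_mem (a : A) :
    a - algebraMap ℝ A (realPart A a) ∈ IsLocalRing.maximalIdeal A := by
  rw [← realPart_eq_zero_iff, map_sub, realPart_algebraMap, sub_self]

theorem realPart_eq_of_sub_mem {a : A} {r : ℝ}
    (h : a - algebraMap ℝ A r ∈ IsLocalRing.maximalIdeal A) : realPart A a = r := by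
  rw [← realPart_eq_zero_iff, map_sub, realPart_algebraMap, sub_eq_zero] at h
  exact h

variable (A) in
theorem exists_maximalIdeal_pow_eq_bot : ∃ N : ℕ, IsLocalRing.maximalIdeal A ^ N = ⊥ := by
  have : IsArtinianRing A := IsArtinianRing.of_finite ℝ A
  have h := IsArtinianRing.isNilpotent_jacobson_bot (R := A)
  rw [IsLocalRing.jacobson_eq_maximalIdeal _ bot_ne_top] at h
  exact h

variable (A) in
/-- An exponent `N` with `𝔪 ^ N = 0`. -/
noncomputable def nilIndex : ℕ := (exists_maximalIdeal_pow_eq_bot A).choose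

theorem eq_zero_of_mem_pow {a : A} (h : a ∈ IsLocalRing.maximalIdeal A ^ nilIndex A) : a = 0 := by
  rw [nilIndex, (exists_maximalIdeal_pow_eq_bot A).choose_spec] at h
  exact h

end Algebra

section Taylor

variable {n : ℕ} {A : Type*} [CommRing A] [Algebra ℝ A]

/-- The partial derivative `∂ᵢ g`. -/
noncomputable def partialDeriv (i : Fin n) (g : EuclideanSpace ℝ (Fin n) → ℝ) :
    EuclideanSpace ℝ (Fin n) → ℝ :=
  fun y => fderiv ℝ g y (EuclideanSpace.single i 1)

/-- The term `∑_{|α| = k} ∂^α g (c) u^α / α!` of the Taylor expansion of `g` at `c` with nilpotent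
increment `u`, defined through `(k + 1) T_{k+1} g = ∑ᵢ uᵢ T_k (∂ᵢ g)`. -/
noncomputable def taylorTerm (u : Fin n → A) :
    ℕ → (EuclideanSpace ℝ (Fin n) → ℝ) → EuclideanSpace ℝ (Fin n) → A
  | 0, g, c => algebraMap ℝ A (g c)
  | k + 1, g, c => ((k : ℝ) + 1)⁻¹ • ∑ i, u i * taylorTerm u k (partialDeriv i g) c

variable {g g' : EuclideanSpace ℝ (Fin n) → ℝ} {c : EuclideanSpace ℝ (Fin n)}

theorem partialDeriv_congr (i : Fin n) (h : g =ᶠ[𝓝 c] g') :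
    partialDeriv i g =ᶠ[𝓝 c] partialDeriv i g' := by
  filter_upwards [h.fderiv (𝕜 := ℝ)] with y hy
  simp [partialDeriv, hy]

theorem taylorTerm_congr (u : Fin n → A) (k : ℕ) (h : g =ᶠ[𝓝 c] g') :
    taylorTerm u k g c = taylorTerm u k g' c := by
  induction k generalizing g g' with
  | zero => simp [taylorTerm, h.eq_of_nhds]
  | succ k ih =>
    simp only [taylorTerm]
    congr 1
    exact Finset.sum_congr rfl fun i _ => by rw [ih (partialDeriv_congr i h)]

/-- Smoothness near a point. -/
def SmoothNear (g : EuclideanSpace ℝ (Fin n) → ℝ) (c : EuclideanSpace ℝ (Fin n)) : Prop :=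
  ∀ᶠ y in 𝓝 c, ContDiffAt ℝ ∞ g y

theorem SmoothNear.partialDeriv (hg : SmoothNear g c) (i : Fin n) :
    SmoothNear (partialDeriv i g) c := by
  filter_upwards [hg] with y hy
  exact (hy.fderiv_right (m := ∞) (by simp)).clm_apply contDiffAt_const

theorem taylorTerm_add (u : Fin n → A) (k : ℕ) (hg : SmoothNear g c) (hg' : SmoothNear g' c) :
    taylorTerm u k (fun y => g y + g' y) c = taylorTerm u k g c + taylorTerm u k g' c := by
  induction k generalizing g g' with
  | zero => simp [taylorTerm]
  | succ k ih =>
    simp only [taylorTerm]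
    rw [← smul_add, ← Finset.sum_add_distrib]
    congr 1
    refine Finset.sum_congr rfl fun i _ => ?_
    rw [← mul_add, ← ih (hg.partialDeriv i) (hg'.partialDeriv i)]
    congr 1
    apply taylorTerm_congr
    filter_upwards [hg, hg'] with y hy hy'
    simp only [WeilAlgebra.partialDeriv]
    rw [fderiv_fun_add (hy.differentiableAt (by simp)) (hy'.differentiableAt (by simp))]
    rfl

theorem taylorTerm_zero (u : Fin n → A) (k : ℕ) : taylorTerm u k (fun _ => 0) c = 0 := by
  induction k with
  | zero => simp [taylorTerm]
  | succ k ih =>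
    have : ∀ i : Fin n, partialDeriv i (fun _ => (0 : ℝ)) = fun _ => 0 := by
      intro i; funext y; simp [partialDeriv]
    simp [taylorTerm, this, ih]

theorem taylorTerm_const (u : Fin n → A) (k : ℕ) (r : ℝ) :
    taylorTerm u (k + 1) (fun _ => r) c = 0 := by
  have : ∀ i : Fin n, partialDeriv i (fun _ => r) = fun _ => 0 := by
    intro i; funext y; simp [partialDeriv]
  simp [taylorTerm, this, taylorTerm_zero]

theorem partialDeriv_coord (i j : Fin n) :
    partialDeriv i (fun y => y j) = fun _ => if i = j then 1 else 0 := by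
  funext y
  have : (fun y : EuclideanSpace ℝ (Fin n) => y j) = EuclideanSpace.proj (𝕜 := ℝ) j := rfl
  rw [partialDeriv, this, ContinuousLinearMap.fderiv]
  simp [eq_comm]

theorem taylorTerm_coord_one (u : Fin n → A) (j : Fin n) :
    taylorTerm u 1 (fun y => y j) c = u j := by
  simp [taylorTerm, partialDeriv_coord]

theorem taylorTerm_coord_add_two (u : Fin n → A) (k : ℕ) (j : Fin n) :
    taylorTerm u (k + 2) (fun y => y j) c = 0 := by
  rw [taylorTerm]
  simp [partialDeriv_coord, taylorTerm_const]

theorem SmoothNear.mul (hg : SmoothNear g c) (hg' : SmoothNear g' c) :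
    SmoothNear (fun y => g y * g' y) c := by
  filter_upwards [hg, hg'] with y hy hy' using hy.mul hy'

theorem taylorTerm_succ (u : Fin n → A) (k : ℕ) :
    ((k : ℝ) + 1) • taylorTerm u (k + 1) g c = ∑ i, u i * taylorTerm u k (partialDeriv i g) c := by
  rw [taylorTerm, smul_inv_smul₀]
  positivity

theorem taylorTerm_mul (u : Fin n → A) (k : ℕ) (hg : SmoothNear g c) (hg' : SmoothNear g' c) :
    taylorTerm u k (fun y => g y * g' y) c =
      ∑ p ∈ Finset.HasAntidiagonal.antidiagonal k, taylorTerm u p.1 g c * taylorTerm u p.2 g' c := by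
  induction k generalizing g g' with
  | zero => simp [taylorTerm]
  | succ k ih =>
    have hk : ((k : ℝ) + 1) ≠ 0 := by positivity
    apply smul_right_injective A hk
    simp only
    rw [taylorTerm_succ]
    have h1 : ∀ i, taylorTerm u k (partialDeriv i fun y => g y * g' y) c =
        ∑ p ∈ Finset.HasAntidiagonal.antidiagonal k,
          (taylorTerm u p.1 (partialDeriv i g) c * taylorTerm u p.2 g' c +
            taylorTerm u p.1 g c * taylorTerm u p.2 (partialDeriv i g') c) := by
      intro i
      rw [Finset.sum_add_distrib, ← ih (hg.partialDeriv i) hg', ← ih hg (hg'.partialDeriv i),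
        ← taylorTerm_add u k ((hg.partialDeriv i).mul hg') (hg.mul (hg'.partialDeriv i))]
      apply taylorTerm_congr
      filter_upwards [hg, hg'] with y hy hy'
      simp only [WeilAlgebra.partialDeriv]
      rw [fderiv_fun_mul (hy.differentiableAt (by simp)) (hy'.differentiableAt (by simp))]
      simp
      ring
    simp only [h1, Finset.mul_sum]
    rw [Finset.sum_comm]
    have h2 : ∀ p ∈ Finset.HasAntidiagonal.antidiagonal k,
        ∑ i, u i * (taylorTerm u p.1 (partialDeriv i g) c * taylorTerm u p.2 g' c +
            taylorTerm u p.1 g c * taylorTerm u p.2 (partialDeriv i g') c) =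
        ((p.1 : ℝ) + 1) • (taylorTerm u (p.1 + 1) g c * taylorTerm u p.2 g' c) +
        ((p.2 : ℝ) + 1) • (taylorTerm u p.1 g c * taylorTerm u (p.2 + 1) g' c) := by
      intro p _
      rw [← smul_mul_assoc, ← mul_smul_comm, taylorTerm_succ, taylorTerm_succ, Finset.sum_mul,
        Finset.mul_sum, ← Finset.sum_add_distrib]
      exact Finset.sum_congr rfl fun i _ => by ring
    rw [Finset.sum_congr rfl h2, Finset.sum_add_distrib]
    have h3 : ∑ p ∈ Finset.HasAntidiagonal.antidiagonal k,
        ((p.1 : ℝ) + 1) • (taylorTerm u (p.1 + 1) g c * taylorTerm u p.2 g' c) =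
        ∑ p ∈ Finset.HasAntidiagonal.antidiagonal (k + 1),
          (p.1 : ℝ) • (taylorTerm u p.1 g c * taylorTerm u p.2 g' c) := by
      rw [Finset.Nat.antidiagonal_succ]
      simp
    have h4 : ∑ p ∈ Finset.HasAntidiagonal.antidiagonal k,
        ((p.2 : ℝ) + 1) • (taylorTerm u p.1 g c * taylorTerm u (p.2 + 1) g' c) =
        ∑ p ∈ Finset.HasAntidiagonal.antidiagonal (k + 1),
          (p.2 : ℝ) • (taylorTerm u p.1 g c * taylorTerm u p.2 g' c) := by
      rw [Finset.Nat.antidiagonal_succ']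
      simp
    rw [h3, h4, ← Finset.sum_add_distrib, Finset.smul_sum]
    refine Finset.sum_congr rfl fun p hp => ?_
    rw [← add_smul]
    congr 1
    rw [Finset.HasAntidiagonal.mem_antidiagonal] at hp
    exact_mod_cast hp

theorem taylorTerm_mem_pow {I : Ideal A} {u : Fin n → A} (hu : ∀ i, u i ∈ I) (k : ℕ)
    (g : EuclideanSpace ℝ (Fin n) → ℝ) : taylorTerm u k g c ∈ I ^ k := by
  induction k generalizing g with
  | zero => simp
  | succ k ih =>
    rw [taylorTerm]
    refine Submodule.smul_of_tower_mem _ _ (Ideal.sum_mem _ fun i _ => ?_)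
    rw [pow_succ']
    exact Ideal.mul_mem_mul (hu i) (ih _)

variable [IsWeilAlgebra A]

/-- The (finite) Taylor expansion of `g` at a point `a ∈ Aⁿ`, written as `a = c + u` with `c ∈ ℝⁿ`
and `u ∈ 𝔪ⁿ`: `∑_α ∂^α g (c) u^α / α!`. -/
noncomputable def taylorAt (u : Fin n → A) (g : EuclideanSpace ℝ (Fin n) → ℝ)
    (c : EuclideanSpace ℝ (Fin n)) : A :=
  ∑ k ∈ Finset.range (nilIndex A), taylorTerm u k g c

theorem nilIndex_pos : 0 < nilIndex A := by
  rcases Nat.eq_zero_or_pos (nilIndex A) with h | h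
  · have : (1 : A) = 0 := eq_zero_of_mem_pow (by simp [h])
    exact absurd this one_ne_zero
  · exact h

theorem taylorAt_congr (u : Fin n → A) (h : g =ᶠ[𝓝 c] g') : taylorAt u g c = taylorAt u g' c :=
  Finset.sum_congr rfl fun k _ => taylorTerm_congr u k h

theorem taylorAt_add (u : Fin n → A) (hg : SmoothNear g c) (hg' : SmoothNear g' c) :
    taylorAt u (fun y => g y + g' y) c = taylorAt u g c + taylorAt u g' c := by
  simp only [taylorAt, ← Finset.sum_add_distrib]
  exact Finset.sum_congr rfl fun k _ => taylorTerm_add u k hg hg'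

theorem taylorAt_const (u : Fin n → A) (r : ℝ) : taylorAt u (fun _ => r) c = algebraMap ℝ A r := by
  rw [taylorAt, ← Nat.succ_pred_eq_of_pos (nilIndex_pos (A := A)), Nat.succ_eq_add_one,
    Finset.sum_range_succ', Finset.sum_eq_zero fun k _ => taylorTerm_const u k r, zero_add]
  rfl

theorem taylorAt_coord {u : Fin n → A} (hu : ∀ i, u i ∈ IsLocalRing.maximalIdeal A) (j : Fin n) :
    taylorAt u (fun y => y j) c = algebraMap ℝ A (c j) + u j := by
  have hz : ∀ k ∉ Finset.range (nilIndex A), taylorTerm u k (fun y => y j) c = 0 := by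
    intro k hk
    exact eq_zero_of_mem_pow (Ideal.pow_le_pow_right (by simpa using hk)
      (taylorTerm_mem_pow hu k _))
  have h : taylorAt u (fun y => y j) c =
      ∑ k ∈ Finset.range (nilIndex A + 2), taylorTerm u k (fun y => y j) c := by
    refine Finset.sum_subset (Finset.range_subset_range.2 (by omega)) fun k _ hk => hz k hk
  rw [h, Finset.sum_range_succ', Finset.sum_range_succ', Finset.sum_eq_zero]
  · simp only [zero_add, taylorTerm_coord_one]
    rw [add_comm]; rfl
  · intro k _
    exact taylorTerm_coord_add_two u k j

theorem taylorAt_mul {u : Fin n → A} (hu : ∀ i, u i ∈ IsLocalRing.maximalIdeal A)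
    (hg : SmoothNear g c) (hg' : SmoothNear g' c) :
    taylorAt u (fun y => g y * g' y) c = taylorAt u g c * taylorAt u g' c := by
  simp only [taylorAt]
  rw [Finset.sum_mul_sum, ← Finset.sum_product']
  rw [← Finset.sum_filter_of_ne (p := fun p : ℕ × ℕ => p.1 + p.2 < nilIndex A)]
  · rw [← Finset.sum_fiberwise_of_maps_to (t := Finset.range (nilIndex A))
      (g := fun p : ℕ × ℕ => p.1 + p.2) (by intro p hp; simp at hp ⊢; exact hp.2)]
    refine Finset.sum_congr rfl fun k hk => ?_
    rw [taylorTerm_mul u k hg hg']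
    refine Finset.sum_congr ?_ fun _ _ => rfl
    ext p
    simp only [Finset.HasAntidiagonal.mem_antidiagonal, Finset.mem_filter, Finset.mem_product, Finset.mem_range]
      at hk ⊢
    omega
  · intro p _ hp
    by_contra hlt
    refine hp (eq_zero_of_mem_pow (Ideal.pow_le_pow_right (not_lt.1 hlt) ?_))
    rw [pow_add]
    exact Ideal.mul_mem_mul (taylorTerm_mem_pow hu _ _) (taylorTerm_mem_pow hu _ _)

theorem taylorAt_sub_mem {u : Fin n → A} (hu : ∀ i, u i ∈ IsLocalRing.maximalIdeal A)
    (g : EuclideanSpace ℝ (Fin n) → ℝ) :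
    taylorAt u g c - algebraMap ℝ A (g c) ∈ IsLocalRing.maximalIdeal A := by
  rw [taylorAt, ← Nat.succ_pred_eq_of_pos (nilIndex_pos (A := A)), Nat.succ_eq_add_one,
    Finset.sum_range_succ']
  have : taylorTerm u 0 g c = algebraMap ℝ A (g c) := rfl
  rw [this, add_sub_cancel_right]
  refine Ideal.sum_mem _ fun k _ => ?_
  have := taylorTerm_mem_pow (c := c) hu (k + 1) g
  exact Ideal.pow_le_self (Nat.succ_ne_zero k) this

end Taylor

section Hadamard

variable {n : ℕ}

theorem contDiff_integral_of_contDiff {F : EuclideanSpace ℝ (Fin n) × ℝ → ℝ}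
    (hF : ContDiff ℝ ∞ F) : ContDiff ℝ ∞ fun y => ∫ t in (0 : ℝ)..1, F (y, t) := by
  obtain ⟨χ, hχ1, hχc, hχs⟩ : ∃ χ : ℝ → ℝ, (∀ s ∈ Set.Icc (-1 : ℝ) 0, χ s = 1) ∧
      HasCompactSupport χ ∧ ContDiff ℝ ∞ χ := by
    let b : ContDiffBump (0 : ℝ) := ⟨1, 2, by norm_num, by norm_num⟩
    refine ⟨b, fun s hs => b.one_of_mem_closedBall ?_, b.hasCompactSupport, b.contDiff⟩
    simp only [Metric.mem_closedBall, dist_zero_right, Real.norm_eq_abs, abs_le, b]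
    exact ⟨hs.1, hs.2.trans zero_le_one⟩
  have hf : MeasureTheory.LocallyIntegrable ((Set.Ioc (0 : ℝ) 1).indicator fun _ => (1 : ℝ))
      MeasureTheory.volume :=
    (MeasureTheory.locallyIntegrable_const 1).indicator measurableSet_Ioc
  have key := MeasureTheory.contDiffOn_convolution_right_with_param (n := ⊤) (𝕜 := ℝ)
    (ContinuousLinearMap.mul ℝ ℝ) (μ := MeasureTheory.volume)
    (g := fun (y : EuclideanSpace ℝ (Fin n)) (s : ℝ) => χ s * F (y, -s))
    (s := Set.univ) (k := tsupport χ) isOpen_univ hχc.isCompact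
    (fun p x _ hx => by simp [image_eq_zero_of_notMem_tsupport hx]) hf (by
      apply ContDiff.contDiffOn
      exact (hχs.comp contDiff_snd).mul
        (hF.comp (contDiff_fst.prodMk contDiff_snd.neg)))
  rw [Set.univ_prod_univ, contDiffOn_univ] at key
  have h2 := key.comp (contDiff_id.prodMk (contDiff_const (c := (0 : ℝ))))
  convert h2 using 1
  funext y
  symm
  simp only [Function.comp, MeasureTheory.convolution, id, ContinuousLinearMap.mul_apply']
  rw [intervalIntegral.integral_of_le zero_le_one, ← MeasureTheory.integral_indicator
    measurableSet_Ioc]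
  refine MeasureTheory.integral_congr_ae (Filter.Eventually.of_forall fun t => ?_)
  by_cases ht : t ∈ Set.Ioc (0 : ℝ) 1
  · have : χ (-t) = 1 := hχ1 _ ⟨by linarith [ht.2], by linarith [ht.1]⟩
    simp [ht, this]
  · simp [ht]

theorem exists_hadamard {g : EuclideanSpace ℝ (Fin n) → ℝ} (hg : ContDiff ℝ ∞ g)
    (c : EuclideanSpace ℝ (Fin n)) :
    ∃ h : Fin n → EuclideanSpace ℝ (Fin n) → ℝ, (∀ i, ContDiff ℝ ∞ (h i)) ∧
      ∀ y, g y = g c + ∑ i, (y i - c i) * h i y := by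
  have hpd : ∀ i, ContDiff ℝ ∞ (partialDeriv i g) := fun i =>
    (hg.fderiv_right (m := ∞) (by simp)).clm_apply contDiff_const
  have hF : ∀ i, ContDiff ℝ ∞ fun p : EuclideanSpace ℝ (Fin n) × ℝ =>
      partialDeriv i g (c + p.2 • (p.1 - c)) := fun i =>
    (hpd i).comp (contDiff_const.add (contDiff_snd.smul (contDiff_fst.sub contDiff_const)))
  refine ⟨fun i y => ∫ t in (0 : ℝ)..1, partialDeriv i g (c + t • (y - c)),
    fun i => contDiff_integral_of_contDiff (hF i), fun y => ?_⟩
  have hderiv : ∀ t : ℝ, HasDerivAt (fun t : ℝ => g (c + t • (y - c)))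
      (∑ i, (y i - c i) * partialDeriv i g (c + t • (y - c))) t := by
    intro t
    have h1 : HasDerivAt (fun t : ℝ => c + t • (y - c)) (y - c) t := by
      simpa using ((hasDerivAt_id t).smul_const (y - c)).const_add c
    have h2 := ((hg.differentiable (by simp)) (c + t • (y - c))).hasFDerivAt.comp_hasDerivAt t h1
    refine h2.congr_deriv ?_
    have h3 : y - c = ∑ i, (y i - c i) • EuclideanSpace.single i (1 : ℝ) := by
      ext j
      simp [Finset.sum_apply, Pi.single_apply]
    have h4 := congrArg (fderiv ℝ g (c + t • (y - c))) h3
    simp only [map_sum, map_smul, smul_eq_mul] at h4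
    exact h4
  have hcont : ∀ i, Continuous fun t : ℝ => partialDeriv i g (c + t • (y - c)) := fun i =>
    (hF i).continuous.comp (continuous_const.prodMk continuous_id)
  have h := intervalIntegral.integral_eq_sub_of_hasDerivAt (a := 0) (b := 1)
    (fun t _ => hderiv t) (Continuous.intervalIntegrable (by fun_prop) _ _)
  rw [intervalIntegral.integral_finsetSum
    (fun i _ => Continuous.intervalIntegrable (by fun_prop) _ _)] at h
  simp only [intervalIntegral.integral_const_mul, one_smul, zero_smul, add_zero,
    add_sub_cancel] at h
  rw [h]; ring

end Hadamard

section Model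

variable (n : ℕ) (A : Type*) [CommRing A] [Algebra ℝ A]

/-- The model vector space of `M^A`: `Aⁿ`, written in coordinates with respect to a basis of `A`. -/
abbrev Model : Type := Fin n → Fin (Module.finrank ℝ A) → ℝ

variable {n A} [IsWeilAlgebra A]

/-- The identification of the model space with `Aⁿ`. -/
noncomputable def toVec (w : Model n A) (i : Fin n) : A :=
  (Module.finBasis ℝ A).equivFun.symm (w i)

/-- The identification of `Aⁿ` with the model space. -/
noncomputable def ofVec (a : Fin n → A) : Model n A :=
  fun i => (Module.finBasis ℝ A).equivFun (a i)

theorem toVec_ofVec (a : Fin n → A) : toVec (ofVec a) = a :=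
  funext fun _ => LinearEquiv.symm_apply_apply _ _

theorem ofVec_toVec (w : Model n A) : ofVec (toVec w) = w :=
  funext fun _ => LinearEquiv.apply_symm_apply _ _

/-- The image in `ℝⁿ` of a point of `Aⁿ`. -/
noncomputable def center (w : Model n A) : EuclideanSpace ℝ (Fin n) :=
  WithLp.toLp 2 fun i => realPart A (toVec w i)

/-- The nilpotent part of a point of `Aⁿ`. -/
noncomputable def nilPart (w : Model n A) (i : Fin n) : A :=
  toVec w i - algebraMap ℝ A (center w i)

theorem nilPart_mem (w : Model n A) (i : Fin n) : nilPart w i ∈ IsLocalRing.maximalIdeal A :=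
  sub_realPart_mem _

theorem contDiff_toVec (ℓ : A →ₗ[ℝ] ℝ) (i : Fin n) :
    ContDiff ℝ ∞ fun w : Model n A => ℓ (toVec w i) := by
  let L : Model n A →ₗ[ℝ] ℝ :=
    ℓ ∘ₗ (Module.finBasis ℝ A).equivFun.symm.toLinearMap ∘ₗ LinearMap.proj i
  exact (LinearMap.toContinuousLinearMap L).contDiff

theorem contDiff_center : ContDiff ℝ ∞ (center : Model n A → EuclideanSpace ℝ (Fin n)) := by
  rw [contDiff_euclidean]
  intro i
  exact contDiff_toVec (realPart A).toLinearMap i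

theorem contDiff_nilPart (ℓ : A →ₗ[ℝ] ℝ) (i : Fin n) :
    ContDiff ℝ ∞ fun w : Model n A => ℓ (nilPart w i) := by
  have : (fun w : Model n A => ℓ (nilPart w i)) =
      fun w => ℓ (toVec w i) - realPart A (toVec w i) * ℓ 1 := by
    funext w
    rw [nilPart, map_sub, Algebra.algebraMap_eq_smul_one, map_smul, smul_eq_mul]
    rfl
  rw [this]
  exact (contDiff_toVec ℓ i).sub
    ((contDiff_toVec (realPart A).toLinearMap i).mul contDiff_const)

theorem contDiffOn_taylorTerm (k : ℕ) {g : EuclideanSpace ℝ (Fin n) → ℝ}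
    {V : Set (EuclideanSpace ℝ (Fin n))} (hV : IsOpen V) (hg : ContDiffOn ℝ ∞ g V)
    (ℓ : A →ₗ[ℝ] ℝ) :
    ContDiffOn ℝ ∞ (fun w : Model n A => ℓ (taylorTerm (nilPart w) k g (center w)))
      (center ⁻¹' V) := by
  induction k generalizing g ℓ with
  | zero =>
    have : (fun w : Model n A => ℓ (taylorTerm (nilPart w) 0 g (center w))) =
        fun w => g (center w) * ℓ 1 := by
      funext w
      rw [taylorTerm, Algebra.algebraMap_eq_smul_one, map_smul, smul_eq_mul]
    rw [this]
    exact (hg.comp contDiff_center.contDiffOn fun _ h => h).mul contDiffOn_const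
  | succ k ih =>
    have hpd : ∀ i, ContDiffOn ℝ ∞ (partialDeriv i g) V := fun i =>
      (hg.fderiv_of_isOpen (m := ∞) hV (by simp)).clm_apply contDiffOn_const
    have : (fun w : Model n A => ℓ (taylorTerm (nilPart w) (k + 1) g (center w))) =
        fun w => ((k : ℝ) + 1)⁻¹ * ∑ i, ∑ j,
          (Module.finBasis ℝ A).coord j (nilPart w i) *
            (ℓ ∘ₗ LinearMap.mulLeft ℝ (Module.finBasis ℝ A j))
              (taylorTerm (nilPart w) k (partialDeriv i g) (center w)) := by
      funext w
      rw [taylorTerm, map_smul, smul_eq_mul, map_sum]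
      congr 1
      refine Finset.sum_congr rfl fun i _ => ?_
      conv_lhs => rw [← (Module.finBasis ℝ A).sum_repr (nilPart w i)]
      rw [Finset.sum_mul, map_sum]
      refine Finset.sum_congr rfl fun j _ => ?_
      rw [smul_mul_assoc, map_smul]
      rfl
    rw [this]
    exact contDiffOn_const.mul (ContDiffOn.sum fun i _ => ContDiffOn.sum fun j _ =>
      (contDiff_nilPart _ i).contDiffOn.mul (ih (hpd i) _))

theorem contDiffOn_taylorAt {g : EuclideanSpace ℝ (Fin n) → ℝ}
    {V : Set (EuclideanSpace ℝ (Fin n))} (hV : IsOpen V) (hg : ContDiffOn ℝ ∞ g V)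
    (ℓ : A →ₗ[ℝ] ℝ) :
    ContDiffOn ℝ ∞ (fun w : Model n A => ℓ (taylorAt (nilPart w) g (center w)))
      (center ⁻¹' V) := by
  simp only [taylorAt, map_sum]
  exact ContDiffOn.sum fun k _ => contDiffOn_taylorTerm k hV hg ℓ

end Model

/-- The algebra `C^∞(M)`. -/
abbrev SmoothFn (n : ℕ) (M : Type*) [TopologicalSpace M]
    [ChartedSpace (EuclideanSpace ℝ (Fin n)) M] : Type _ :=
  C^∞⟮𝓡 n, M; ℝ⟯

/-- The set `M^A` of near points of kind `A`: a point `x` of `M` with a morphism of algebras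
`ξ : C^∞(M) → A` such that `ξ(f) - f(x) ∈ 𝔪` for all `f`. -/
structure NearPoint (n : ℕ) (M : Type*) [TopologicalSpace M]
    [ChartedSpace (EuclideanSpace ℝ (Fin n)) M]
    (A : Type*) [CommRing A] [Algebra ℝ A] [IsWeilAlgebra A] where
  /-- The origin `π_M(ξ)`. -/
  base : M
  toHom : SmoothFn n M →ₐ[ℝ] A
  sub_mem : ∀ f, toHom f - algebraMap ℝ A (f base) ∈ IsLocalRing.maximalIdeal A

section Manifold

set_option linter.unusedSectionVars false

variable {n : ℕ} {M : Type*} [TopologicalSpace M] [ChartedSpace (EuclideanSpace ℝ (Fin n)) M]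
  [IsManifold (𝓡 n) ∞ M] [T2Space M]
  {A : Type*} [CommRing A] [Algebra ℝ A] [IsWeilAlgebra A]

theorem exists_extension {f : M → ℝ} {x : M}
    (hf : ∀ᶠ y in 𝓝 x, ContMDiffAt (𝓡 n) 𝓘(ℝ, ℝ) ∞ f y) :
    ∃ F : SmoothFn n M, F =ᶠ[𝓝 x] f := by
  obtain ⟨b, -, hb⟩ := (SmoothBumpFunction.nhds_basis_tsupport (I := 𝓡 n) x).mem_iff.1 hf
  refine ⟨⟨fun y => b y * f y, contMDiff_of_tsupport fun y hy => ?_⟩, ?_⟩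
  · have hy' : y ∈ tsupport b := tsupport_smul_subset_left (⇑b) f hy
    exact b.contMDiff.contMDiffAt.mul (hb hy')
  · filter_upwards [b.eventuallyEq_one] with y hy
    simp [hy]

theorem exists_bump {x : M} {s : Set M} (hs : s ∈ 𝓝 x) :
    ∃ F : SmoothFn n M, F x = 1 ∧ ∀ y ∉ s, F y = 0 := by
  obtain ⟨b, -, hb⟩ := (SmoothBumpFunction.nhds_basis_tsupport (I := 𝓡 n) x).mem_iff.1 hs
  refine ⟨⟨b, b.contMDiff⟩, b.eq_one, fun y hy => ?_⟩
  exact image_eq_zero_of_notMem_tsupport fun h => hy (hb h)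

theorem exists_ne {x y : M} (hxy : x ≠ y) : ∃ F : SmoothFn n M, F x = 1 ∧ F y = 0 := by
  obtain ⟨F, h1, h2⟩ := exists_bump (n := n) (isOpen_compl_singleton.mem_nhds hxy)
  exact ⟨F, h1, h2 y (by simp)⟩

namespace NearPoint

theorem realPart_toHom (ξ : NearPoint n M A) (f : SmoothFn n M) :
    realPart A (ξ.toHom f) = f ξ.base :=
  realPart_eq_of_sub_mem (ξ.sub_mem f)

theorem toHom_eq_zero (ξ : NearPoint n M A) {f : SmoothFn n M} (hf : f =ᶠ[𝓝 ξ.base] 0) :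
    ξ.toHom f = 0 := by
  obtain ⟨F, h1, h2⟩ := exists_bump (n := n) hf
  have hF : f * F = 0 := by
    ext y
    by_cases hy : f y = 0
    · simp [hy]
    · simp [h2 y hy]
  have hu : IsUnit (ξ.toHom F) := by
    by_contra h
    have := (realPart_eq_zero_iff _).2 ((IsLocalRing.mem_maximalIdeal _).2 h)
    rw [realPart_toHom, h1] at this
    exact one_ne_zero this
  have := congrArg ξ.toHom hF
  rw [map_mul, map_zero] at this
  exact (hu.mul_left_eq_zero).1 this

theorem toHom_congr (ξ : NearPoint n M A) {f g : SmoothFn n M} (h : f =ᶠ[𝓝 ξ.base] g) :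
    ξ.toHom f = ξ.toHom g := by
  rw [← sub_eq_zero, ← map_sub]
  apply toHom_eq_zero
  filter_upwards [h] with y hy
  simp [hy]

theorem ext_of_toHom {ξ η : NearPoint n M A} (h : ξ.toHom = η.toHom) : ξ = η := by
  have hb : ξ.base = η.base := by
    by_contra hne
    obtain ⟨F, h1, h2⟩ := exists_ne (n := n) hne
    have h3 := realPart_toHom ξ F
    rw [h, realPart_toHom, h1, h2] at h3
    exact zero_ne_one h3
  cases ξ; cases η
  simp only at h hb
  subst h; subst hb; rfl

open Classical in
/-- The value of a near point `ξ` on a function which is smooth near its origin: `ξ(F)` for any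
smooth function `F` on `M` with the same germ. -/
noncomputable def germEval (ξ : NearPoint n M A) (f : M → ℝ) : A :=
  if h : ∃ F : SmoothFn n M, F =ᶠ[𝓝 ξ.base] f then ξ.toHom h.choose else 0

theorem germEval_eq (ξ : NearPoint n M A) {f : M → ℝ} {F : SmoothFn n M}
    (hF : F =ᶠ[𝓝 ξ.base] f) : ξ.germEval f = ξ.toHom F := by
  have h : ∃ F : SmoothFn n M, F =ᶠ[𝓝 ξ.base] f := ⟨F, hF⟩
  rw [germEval, dif_pos h]
  exact ξ.toHom_congr (h.choose_spec.trans hF.symm)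

end NearPoint

theorem eventually_contMDiffAt_coord {e : OpenPartialHomeomorph M (EuclideanSpace ℝ (Fin n))}
    (he : e ∈ atlas (EuclideanSpace ℝ (Fin n)) M) {x : M} (hx : x ∈ e.source)
    {h : EuclideanSpace ℝ (Fin n) → ℝ} (hh : ContDiff ℝ ∞ h) :
    ∀ᶠ y in 𝓝 x, ContMDiffAt (𝓡 n) 𝓘(ℝ, ℝ) ∞ (fun y => h (e y)) y := by
  filter_upwards [e.open_source.mem_nhds hx] with y hy
  have h1 := contMDiffOn_of_mem_maximalAtlas (I := 𝓡 n) (n := ∞)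
    (IsManifold.subset_maximalAtlas he)
  exact hh.contMDiff.contMDiffAt.comp y (h1.contMDiffAt (e.open_source.mem_nhds hy))

theorem contDiffOn_comp_symm {e : OpenPartialHomeomorph M (EuclideanSpace ℝ (Fin n))}
    (he : e ∈ atlas (EuclideanSpace ℝ (Fin n)) M) (f : SmoothFn n M) :
    ContDiffOn ℝ ∞ (fun y => f (e.symm y)) e.target := by
  rw [← contMDiffOn_iff_contDiffOn]
  exact f.contMDiff.comp_contMDiffOn (contMDiffOn_symm_of_mem_maximalAtlas (I := 𝓡 n) (n := ∞)
    (IsManifold.subset_maximalAtlas he))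

theorem smoothNear_of_contDiffOn {g : EuclideanSpace ℝ (Fin n) → ℝ}
    {V : Set (EuclideanSpace ℝ (Fin n))} (hV : IsOpen V) (hg : ContDiffOn ℝ ∞ g V)
    {c : EuclideanSpace ℝ (Fin n)} (hc : c ∈ V) : SmoothNear g c := by
  filter_upwards [hV.mem_nhds hc] with y hy using hg.contDiffAt (hV.mem_nhds hy)

namespace NearPoint

/-- Two near points with the same values on local coordinates are equal. -/
theorem eq_of_coord_eq {e : OpenPartialHomeomorph M (EuclideanSpace ℝ (Fin n))}
    (he : e ∈ atlas (EuclideanSpace ℝ (Fin n)) M) {ξ η : NearPoint n M A}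
    (hb : ξ.base = η.base) (hξ : ξ.base ∈ e.source)
    (h : ∀ i, ξ.germEval (fun y => e y i) = η.germEval (fun y => e y i)) : ξ = η := by
  have key : ∀ N : ℕ, ∀ f : SmoothFn n M,
      ξ.toHom f - η.toHom f ∈ IsLocalRing.maximalIdeal A ^ N := by
    intro N
    induction N with
    | zero => intro f; simp
    | succ N ih =>
      intro f
      set x := ξ.base with hx
      set c := e x with hc
      have hct : c ∈ e.target := e.map_source hξ
      -- a globally smooth representative of `f` in the chart
      obtain ⟨g, hg, hgf⟩ : ∃ g : EuclideanSpace ℝ (Fin n) → ℝ, ContDiff ℝ ∞ g ∧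
          g =ᶠ[𝓝 c] fun y => f (e.symm y) := by
        obtain ⟨G, hG⟩ := exists_extension (n := n) (M := EuclideanSpace ℝ (Fin n))
          (f := fun y => f (e.symm y)) (x := c) (by
            filter_upwards [e.open_target.mem_nhds hct] with y hy
            exact ((contDiffOn_comp_symm he f).contDiffAt
              (e.open_target.mem_nhds hy)).contMDiffAt)
        exact ⟨G, G.contMDiff.contDiff, hG⟩
      obtain ⟨k, hk, hgk⟩ := exists_hadamard hg c
      choose K hK using fun i => exists_extension (n := n)
        (eventually_contMDiffAt_coord he hξ (hk i))
      choose X hX using fun i : Fin n => exists_extension (n := n)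
        (eventually_contMDiffAt_coord he hξ
          (h := fun y => y i) (EuclideanSpace.proj (𝕜 := ℝ) i).contDiff)
      have hfe : f =ᶠ[𝓝 x] (algebraMap ℝ (SmoothFn n M) (g c) +
          ∑ i, (X i - algebraMap ℝ (SmoothFn n M) (c i)) * K i : SmoothFn n M) := by
        have h1 : ∀ᶠ y in 𝓝 x, g (e y) = f (e.symm (e y)) :=
          (e.continuousAt hξ).eventually hgf
        filter_upwards [h1, e.open_source.mem_nhds hξ, Filter.eventually_all.2 hK,
          Filter.eventually_all.2 hX] with y h1 h2 h3 h4
        rw [e.left_inv h2, hgk] at h1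
        rw [← h1]
        have hs : ∀ (s : Finset (Fin n)) (Φ : Fin n → SmoothFn n M),
            (∑ i ∈ s, Φ i : SmoothFn n M) y = ∑ i ∈ s, Φ i y := fun s Φ =>
          map_sum (ContMDiffMap.coeFnRingHom (I := 𝓡 n) (I' := 𝓘(ℝ, ℝ)) (N := M) (R := ℝ)
            (n := ∞) |>.toAddMonoidHom |> (Pi.evalAddMonoidHom _ y).comp) Φ s
        rw [ContMDiffMap.coe_add, Pi.add_apply, hs]
        congr 1
        refine Finset.sum_congr rfl fun i _ => ?_
        rw [ContMDiffMap.coe_mul, Pi.mul_apply, h3, ContMDiffMap.coe_sub, Pi.sub_apply, h4]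
        rfl
      have e1 := ξ.toHom_congr hfe
      have hfe' := hfe
      rw [hb] at hfe'
      have e2 := η.toHom_congr hfe'
      rw [e1, e2]
      simp only [map_add, map_sum, map_mul, map_sub, AlgHom.commutes]
      rw [add_sub_add_left_eq_sub, ← Finset.sum_sub_distrib]
      refine Ideal.sum_mem _ fun i _ => ?_
      have hXi : ξ.toHom (X i) = η.toHom (X i) := by
        have hX' := hX i
        rw [hb] at hX'
        rw [← ξ.germEval_eq (hX i), ← η.germEval_eq hX']
        exact h i
      rw [← hXi, ← mul_sub, pow_succ']
      refine Ideal.mul_mem_mul ?_ (ih (K i))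
      have h5 := ξ.sub_mem (X i)
      have h6 : X i ξ.base = c i := (hX i).eq_of_nhds
      rwa [h6] at h5
  refine ext_of_toHom (AlgHom.ext fun f => sub_eq_zero.1 (eq_zero_of_mem_pow (key _ f)))

open Classical in
/-- The near point with coordinates `w ∈ Aⁿ` in the chart `e`. -/
noncomputable def ofCoord (e : OpenPartialHomeomorph M (EuclideanSpace ℝ (Fin n)))
    (he : e ∈ atlas (EuclideanSpace ℝ (Fin n)) M) (w : Model n A) : NearPoint n M A :=
  if hw : center w ∈ e.target then
    { base := e.symm (center w)
      toHom :=
        { toFun := fun f => taylorAt (nilPart w) (fun y => f (e.symm y)) (center w)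
          map_one' := by
            have := taylorAt_const (c := center w) (nilPart w) 1
            rw [map_one] at this
            exact this
          map_zero' := by
            have := taylorAt_const (c := center w) (nilPart w) 0
            rw [map_zero] at this
            exact this
          map_mul' := fun f g => taylorAt_mul (nilPart_mem w)
            (smoothNear_of_contDiffOn e.open_target (contDiffOn_comp_symm he f) hw)
            (smoothNear_of_contDiffOn e.open_target (contDiffOn_comp_symm he g) hw)
          map_add' := fun f g => taylorAt_add (nilPart w)
            (smoothNear_of_contDiffOn e.open_target (contDiffOn_comp_symm he f) hw)
            (smoothNear_of_contDiffOn e.open_target (contDiffOn_comp_symm he g) hw)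
          commutes' := fun r => taylorAt_const (nilPart w) r }
      sub_mem := fun f => taylorAt_sub_mem (nilPart_mem w) _ }
  else
    { base := e.symm (center w)
      toHom := (Algebra.ofId ℝ A).comp
        { toFun := fun f => f (e.symm (center w))
          map_one' := rfl
          map_zero' := rfl
          map_mul' := fun _ _ => rfl
          map_add' := fun _ _ => rfl
          commutes' := fun _ => rfl }
      sub_mem := fun f => by
        rw [← realPart_eq_zero_iff, map_sub, realPart_algebraMap, sub_eq_zero]
        exact realPart_algebraMap _ }

variable {e : OpenPartialHomeomorph M (EuclideanSpace ℝ (Fin n))}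
  (he : e ∈ atlas (EuclideanSpace ℝ (Fin n)) M)

theorem base_ofCoord (w : Model n A) : (ofCoord e he w).base = e.symm (center w) := by
  rw [ofCoord]; split_ifs <;> rfl

theorem toHom_ofCoord {w : Model n A} (hw : center w ∈ e.target) (f : SmoothFn n M) :
    (ofCoord e he w).toHom f =
      taylorAt (nilPart w) (fun y => f (e.symm y)) (center w) := by
  rw [ofCoord, dif_pos hw]; rfl

theorem germEval_ofCoord {w : Model n A} (hw : center w ∈ e.target) {f : M → ℝ}
    (hf : ∀ᶠ y in 𝓝 (e.symm (center w)), ContMDiffAt (𝓡 n) 𝓘(ℝ, ℝ) ∞ f y) :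
    (ofCoord e he w).germEval f =
      taylorAt (nilPart w) (fun y => f (e.symm y)) (center w) := by
  obtain ⟨F, hF⟩ := exists_extension hf
  rw [germEval_eq (F := F) _ (by rwa [base_ofCoord]), toHom_ofCoord he hw]
  apply taylorAt_congr
  exact (e.symm.continuousAt hw).eventually hF

/-- The chart `e^A : U^A → e(U)^A ⊆ Aⁿ` of `M^A` induced by a chart `e` of `M` with domain `U`:
it sends `ξ` to its values on the coordinate functions. -/
noncomputable def chart (e : OpenPartialHomeomorph M (EuclideanSpace ℝ (Fin n)))
    (he : e ∈ atlas (EuclideanSpace ℝ (Fin n)) M) :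
    PartialEquiv (NearPoint n M A) (Model n A) where
  toFun ξ := ofVec fun i => ξ.germEval fun y => e y i
  invFun w := ofCoord e he w
  source := {ξ | ξ.base ∈ e.source}
  target := {w | center w ∈ e.target}
  map_source' := by
    intro ξ hξ
    have : center (ofVec fun i => ξ.germEval fun y => e y i) = e ξ.base := by
      ext i
      obtain ⟨X, hX⟩ := exists_extension (n := n) (eventually_contMDiffAt_coord he hξ
          (h := fun y => y i) (EuclideanSpace.proj (𝕜 := ℝ) i).contDiff)
      simp only [center, toVec_ofVec]
      rw [ξ.germEval_eq hX, realPart_toHom]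
      exact hX.eq_of_nhds
    simp only [Set.mem_ofPred_eq, this]
    exact e.map_source hξ
  map_target' := by
    intro w hw
    simp only [Set.mem_ofPred_eq, base_ofCoord]
    exact e.map_target hw
  left_inv' := by
    intro ξ hξ
    have hc : center (ofVec fun i => ξ.germEval fun y => e y i) = e ξ.base := by
      ext i
      obtain ⟨X, hX⟩ := exists_extension (n := n) (eventually_contMDiffAt_coord he hξ
          (h := fun y => y i) (EuclideanSpace.proj (𝕜 := ℝ) i).contDiff)
      simp only [center, toVec_ofVec]
      rw [ξ.germEval_eq hX, realPart_toHom]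
      exact hX.eq_of_nhds
    have hb : (ofCoord e he (ofVec fun i => ξ.germEval fun y => e y i)).base = ξ.base := by
      rw [base_ofCoord, hc, e.left_inv hξ]
    have ht : center (ofVec fun i => ξ.germEval fun y => e y i) ∈ e.target := by
      rw [hc]; exact e.map_source hξ
    refine eq_of_coord_eq he hb (by rw [hb]; exact hξ) fun i => ?_
    rw [germEval_ofCoord he ht (eventually_contMDiffAt_coord he (e.map_target ht)
      (h := fun y => y i) (EuclideanSpace.proj (𝕜 := ℝ) i).contDiff)]
    rw [taylorAt_congr (g' := fun y => y i) _ (by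
      filter_upwards [e.open_target.mem_nhds ht] with y hy
      rw [e.right_inv hy]), taylorAt_coord (nilPart_mem _)]
    simp [nilPart, toVec_ofVec]
  right_inv' := by
    intro w hw
    have : (fun i => (ofCoord e he w).germEval fun y => e y i) = toVec w := by
      funext i
      rw [germEval_ofCoord he hw (eventually_contMDiffAt_coord he (e.map_target hw)
        (h := fun y => y i) (EuclideanSpace.proj (𝕜 := ℝ) i).contDiff)]
      rw [taylorAt_congr (g' := fun y => y i) _ (by
        filter_upwards [e.open_target.mem_nhds hw] with y hy
        rw [e.right_inv hy]), taylorAt_coord (nilPart_mem _)]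
      simp [nilPart]
    rw [this, ofVec_toVec]

theorem source_symm_trans_chart {e' : OpenPartialHomeomorph M (EuclideanSpace ℝ (Fin n))}
    (he' : e' ∈ atlas (EuclideanSpace ℝ (Fin n)) M) :
    ((chart (A := A) e he).symm.trans (chart e' he')).source =
      center ⁻¹' (e.symm.trans e').source := by
  ext w
  simp [chart, base_ofCoord]

/-- The changes of charts of `M^A` are smooth. -/
theorem contDiffOn_symm_trans_chart {e' : OpenPartialHomeomorph M (EuclideanSpace ℝ (Fin n))}
    (he' : e' ∈ atlas (EuclideanSpace ℝ (Fin n)) M) :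
    ContDiffOn ℝ ∞ ((chart (A := A) e he).symm.trans (chart e' he'))
      ((chart (A := A) e he).symm.trans (chart e' he')).source := by
  rw [source_symm_trans_chart, contDiffOn_pi]
  intro i
  rw [contDiffOn_pi]
  intro j
  have htr : ContDiffOn ℝ ∞ (fun y => e' (e.symm y) i) (e.symm.trans e').source := by
    rw [← contMDiffOn_iff_contDiffOn]
    have h1 := contMDiffOn_of_mem_maximalAtlas (I := 𝓡 n) (n := ∞)
      (IsManifold.subset_maximalAtlas he')
    have h2 := contMDiffOn_symm_of_mem_maximalAtlas (I := 𝓡 n) (n := ∞)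
      (IsManifold.subset_maximalAtlas he)
    have h3 : ContMDiffOn (𝓡 n) (𝓡 n) ∞ (fun y => e' (e.symm y)) (e.symm.trans e').source :=
      h1.comp (h2.mono fun y hy => by simp at hy; exact hy.1) fun y hy => by simp at hy; exact hy.2
    exact (EuclideanSpace.proj (𝕜 := ℝ) i).contDiff.contMDiff.comp_contMDiffOn h3
  refine (contDiffOn_taylorAt (e.symm.trans e').open_source htr
    ((Module.finBasis ℝ A).coord j)).congr fun w hw => ?_
  simp only [Set.mem_preimage, OpenPartialHomeomorph.trans_source,
    OpenPartialHomeomorph.symm_source, Set.mem_inter_iff] at hw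
  rw [← germEval_ofCoord he hw.1 (f := fun y => e' y i) (eventually_contMDiffAt_coord he' hw.2
    (h := fun y => y i) (EuclideanSpace.proj (𝕜 := ℝ) i).contDiff)]
  rfl

variable (n M A) in
/-- The atlas of `M^A` induced by the atlas of `M`. -/
noncomputable def core : ChartedSpaceCore (Model n A) (NearPoint n M A) where
  atlas := {φ | ∃ e, ∃ he : e ∈ atlas (EuclideanSpace ℝ (Fin n)) M, φ = chart e he}
  chartAt ξ := chart (chartAt (EuclideanSpace ℝ (Fin n)) ξ.base) (chart_mem_atlas _ _)
  mem_chart_source ξ := mem_chart_source (EuclideanSpace ℝ (Fin n)) ξ.base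
  chart_mem_atlas ξ := ⟨_, chart_mem_atlas _ _, rfl⟩
  open_source := by
    rintro _ _ ⟨e, he, rfl⟩ ⟨e', he', rfl⟩
    rw [source_symm_trans_chart]
    exact (e.symm.trans e').open_source.preimage contDiff_center.continuous
  continuousOn_toFun := by
    rintro _ _ ⟨e, he, rfl⟩ ⟨e', he', rfl⟩
    exact (contDiffOn_symm_trans_chart he he').continuousOn

noncomputable instance : TopologicalSpace (NearPoint n M A) := (core n M A).toTopologicalSpace

noncomputable instance : ChartedSpace (Model n A) (NearPoint n M A) := (core n M A).toChartedSpace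

/-- `M^A` is a smooth manifold. -/
instance : IsManifold 𝓘(ℝ, Model n A) ∞ (NearPoint n M A) := by
  apply isManifold_of_contDiffOn
  intro φ φ' hφ hφ'
  change φ ∈ ⋃ (ψ) (h : ψ ∈ (core n M A).atlas), {(core n M A).openPartialHomeomorph ψ h} at hφ
  change φ' ∈ ⋃ (ψ) (h : ψ ∈ (core n M A).atlas), {(core n M A).openPartialHomeomorph ψ h} at hφ'
  obtain ⟨_, ⟨e, he, rfl⟩, h⟩ : ∃ ψ, ∃ h : ψ ∈ (core n M A).atlas,
      φ = (core n M A).openPartialHomeomorph ψ h := by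
    simpa only [Set.mem_iUnion, Set.mem_singleton_iff] using hφ
  obtain ⟨_, ⟨e', he', rfl⟩, h'⟩ : ∃ ψ, ∃ h : ψ ∈ (core n M A).atlas,
      φ' = (core n M A).openPartialHomeomorph ψ h := by
    simpa only [Set.mem_iUnion, Set.mem_singleton_iff] using hφ'
  subst h h'
  refine (contDiffOn_symm_trans_chart (A := A) he he').mono fun w hw => ?_
  exact hw.1

end NearPoint

variable (n M A) in
/-- The `A`-algebra `C^∞(M^A, A)` of smooth functions on `M^A` with values in `A`, where `A` is
regarded as a finite-dimensional real vector space. -/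
noncomputable def smoothFnA : Subalgebra A (NearPoint n M A → A) where
  carrier := {φ | ∀ ℓ : A →ₗ[ℝ] ℝ, ContMDiff 𝓘(ℝ, Model n A) 𝓘(ℝ, ℝ) ∞ fun ξ => ℓ (φ ξ)}
  mul_mem' := by
    intro φ ψ hφ hψ ℓ
    have : (fun ξ => ℓ ((φ * ψ) ξ)) = fun ξ => ∑ j, (Module.finBasis ℝ A).coord j (φ ξ) *
        (ℓ ∘ₗ LinearMap.mulLeft ℝ (Module.finBasis ℝ A j)) (ψ ξ) := by
      funext ξ
      rw [Pi.mul_apply]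
      conv_lhs => rw [← (Module.finBasis ℝ A).sum_repr (φ ξ)]
      rw [Finset.sum_mul, map_sum]
      refine Finset.sum_congr rfl fun j _ => ?_
      rw [smul_mul_assoc, map_smul]
      rfl
    rw [this]
    exact contMDiff_finsetSum fun j _ => (hφ _).mul (hψ _)
  add_mem' := by
    intro φ ψ hφ hψ ℓ
    simp only [Pi.add_apply, map_add]
    exact (hφ ℓ).add (hψ ℓ)
  algebraMap_mem' := fun a ℓ => contMDiff_const (c := ℓ a)

variable (A) in
/-- The prolongation `f^A : M^A → A`, `ξ ↦ ξ(f)`, of `f ∈ C^∞(M)`. -/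
noncomputable def prolongFn (f : SmoothFn n M) : smoothFnA n M A :=
  ⟨fun ξ => ξ.toHom f, by
    change ∀ ℓ : A →ₗ[ℝ] ℝ, ContMDiff 𝓘(ℝ, Model n A) 𝓘(ℝ, ℝ) ∞
      fun ξ : NearPoint n M A => ℓ (ξ.toHom f)
    intro ℓ ξ
    have hmem : (NearPoint.core n M A).openPartialHomeomorph _
        ((NearPoint.core n M A).chart_mem_atlas ξ) ∈ atlas (Model n A) (NearPoint n M A) :=
      chart_mem_atlas _ ξ
    set e := chartAt (EuclideanSpace ℝ (Fin n)) ξ.base with hedef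
    have he : e ∈ atlas (EuclideanSpace ℝ (Fin n)) M := chart_mem_atlas _ _
    have h1 := contDiffOn_taylorAt (A := A) e.open_target (contDiffOn_comp_symm he f) ℓ
    have hsrc : ξ.base ∈ e.source := mem_chart_source _ _
    have h2 := (contMDiffOn_iff_contDiffOn.2 h1).comp
      (contMDiffOn_chart (I := 𝓘(ℝ, Model n A)) (n := ∞) (x := ξ))
      (fun η hη => (NearPoint.chart e he).map_source hη)
    have h3 := h2.contMDiffAt ((chartAt (Model n A) ξ).open_source.mem_nhds
      (mem_chart_source _ _))
    refine h3.congr_of_eventuallyEq ?_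
    filter_upwards [(chartAt (Model n A) ξ).open_source.mem_nhds (mem_chart_source _ _)] with η hη
    have h4 : NearPoint.ofCoord e he (NearPoint.chart e he η) = η :=
      (NearPoint.chart e he).left_inv hη
    have h5 : center (NearPoint.chart e he η) ∈ e.target := (NearPoint.chart e he).map_source hη
    conv_lhs => rw [← h4]
    rw [NearPoint.toHom_ofCoord he h5]
    rfl⟩

/-- The functions in `C^∞(M^A) ⊆ C^∞(M^A, A)`. -/
def IsRealValued (φ : smoothFnA n M A) : Prop :=
  ∀ ξ, ∃ r : ℝ, (φ : NearPoint n M A → A) ξ = algebraMap ℝ A r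

/-- The vector fields on `M^A`, as `A`-linear derivations of `C^∞(M^A, A)`: a derivation of
`C^∞(M^A)` extended `A`-linearly to `C^∞(M^A, A) = A ⊗ C^∞(M^A)`, that is, an `A`-linear derivation
which maps `C^∞(M^A)` into itself. -/
def IsVectorField (X : Derivation A (smoothFnA n M A) (smoothFnA n M A)) : Prop :=
  ∀ φ, IsRealValued φ → IsRealValued (X φ)

/-- `X` is a prolongation to `M^A` of the vector field `θ` on `M`: `X(f^A) = (θ(f))^A`. -/
def IsProlongation (θ : Derivation ℝ (SmoothFn n M) (SmoothFn n M))
    (X : Derivation A (smoothFnA n M A) (smoothFnA n M A)) : Prop :=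
  IsVectorField X ∧ ∀ f, X (prolongFn A f) = prolongFn A (θ f)

variable (A) in
/-- The prolongation `θ^A` of a vector field `θ` on `M`: the vector field on `M^A` with
`θ^A(f^A) = (θ(f))^A` for all `f`. -/
noncomputable def prolong (θ : Derivation ℝ (SmoothFn n M) (SmoothFn n M)) :
    Derivation A (smoothFnA n M A) (smoothFnA n M A) :=
  Classical.epsilon (IsProlongation θ)

end Manifold

/-- A Poisson structure on `M`: a real Lie algebra bracket on `C^∞(M)` which is a derivation in its
second argument. -/
structure PoissonBracket (n : ℕ) (M : Type*) [TopologicalSpace M]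
    [ChartedSpace (EuclideanSpace ℝ (Fin n)) M] where
  bracket : SmoothFn n M →ₗ[ℝ] SmoothFn n M →ₗ[ℝ] SmoothFn n M
  bracket_self : ∀ f, bracket f f = 0
  jacobi : ∀ f g h, bracket f (bracket g h) + bracket g (bracket h f) +
    bracket h (bracket f g) = 0
  leibniz : ∀ f g h, bracket f (g * h) = bracket f g * h + g * bracket f h

namespace PoissonBracket

section

variable {n : ℕ} {M : Type*} [TopologicalSpace M] [ChartedSpace (EuclideanSpace ℝ (Fin n)) M]
  (P : PoissonBracket n M)

/-- The derivation `ad(f) = {f, ·}`. -/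
noncomputable def ad (f : SmoothFn n M) : Derivation ℝ (SmoothFn n M) (SmoothFn n M) :=
  Derivation.mk' (P.bracket f) fun g h => by
    rw [P.leibniz, smul_eq_mul, smul_eq_mul]
    ring

/-- The operator `d_ad` in degree `0`: `d_ad(f)` is the cochain `g ↦ {f, g}`. -/
noncomputable def dAd (f : SmoothFn n M) : Derivation ℝ (SmoothFn n M) (SmoothFn n M) := P.ad f

/-- `θ` is globally Hamiltonian: `θ = d_ad(f)` for some `f ∈ C^∞(M)`. -/
def IsGloballyHamiltonian (θ : Derivation ℝ (SmoothFn n M) (SmoothFn n M)) : Prop :=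
  ∃ f, θ = P.dAd f

end

section

variable {n : ℕ} {M : Type*} [TopologicalSpace M] [ChartedSpace (EuclideanSpace ℝ (Fin n)) M]
  [IsManifold (𝓡 n) ∞ M] [T2Space M]
  {A : Type*} [CommRing A] [Algebra ℝ A] [IsWeilAlgebra A] (P : PoissonBracket n M)

/-- `X` is the vector field `τ_φ` on `M^A` attached to `φ ∈ C^∞(M^A, A)`, characterized by
`τ_φ(f^A) = -[ad(f)]^A(φ)` for all `f ∈ C^∞(M)`; the bracket on `M^A` is `{φ, ψ}_A = τ_φ(ψ)`. -/
def IsTau (φ : smoothFnA n M A) (X : Derivation A (smoothFnA n M A) (smoothFnA n M A)) : Prop :=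
  IsVectorField X ∧ ∀ f, X (prolongFn A f) = -prolong A (P.ad f) φ

/-- `X = d_A(φ)`, where `d_A` is the cohomology operator of the adjoint representation
`φ ↦ τ_φ` in degree `0`: `d_A(φ)` is the cochain `ψ ↦ τ_φ(ψ) = {φ, ψ}_A`. -/
def IsDifferential (φ : smoothFnA n M A)
    (X : Derivation A (smoothFnA n M A) (smoothFnA n M A)) : Prop :=
  ∃ Y, P.IsTau φ Y ∧ ∀ ψ, X ψ = Y ψ

/-- `X` is globally Hamiltonian: `X = d_A(φ)` for some `φ ∈ C^∞(M^A, A)`. -/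
def IsGloballyHamiltonianA (X : Derivation A (smoothFnA n M A) (smoothFnA n M A)) : Prop :=
  ∃ φ, P.IsDifferential φ X

end

end PoissonBracket

end WeilAlgebra

/-!
A tangent vector of `M^A` at a near point `ξ` is the same as a derivation `δ : C^∞(M) → A` along
`ξ`, and such a `δ` is determined by its values on local coordinates: by Hadamard's lemma a `δ` which
vanishes on them takes its values in every power of the nilpotent ideal `𝔪`
(`IsDerivationAt.eq_zero_of_coord`).

*Existence of `θ^A`.* The vector `θ^A(ξ)` is given in a chart `(x₁, …, xₙ)` by
`(ξ(θ(x₁)), …, ξ(θ(xₙ))) ∈ Aⁿ`. The derivative of `f^A` along it is a derivation along `ξ` in `f`,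
because near points are multiplicative, and so is `f ↦ ξ(θ(f))`; they agree on the coordinates, hence
everywhere (`prolongAt_prolongFn`). Applied to the coordinates of a second chart, this shows
that the vector does not depend on the chart (`prolongAt_chart_indep`), which yields smoothness
(`prolongFun_mem`).

*Uniqueness of `θ^A`.* The difference `D` of two prolongations kills every `f^A`. It preserves
real-valued functions, so it kills the real components of every `f^A`
(`IsVectorField.apply_component_eq_zero`), in particular coordinates of `M^A` and functions pulled
back from `M`. For a suitable cut-off function `β` pulled back from `M`, a smooth function `ψ` on `M^A`
satisfies `β ψ = β g` with `g` a smooth function of coordinates. Hadamard's lemma on `Aⁿ` gives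
`D(g) = 0`, and `D(β) = 0`, so that `D(ψ) = 0` where `β = 1` (`IsVectorField.eq_zero`).

*The Hamiltonian vector field.* By antisymmetry of the bracket, the equations defining `τ_φ` for
`φ = f^A` are those defining `[ad(f)]^A` (`PoissonBracket.isTau_prolongFn_iff`).
-/

namespace WeilAlgebra

section Prolongation

set_option linter.unusedSectionVars false

variable {n : ℕ} {M : Type*} [TopologicalSpace M] [ChartedSpace (EuclideanSpace ℝ (Fin n)) M]
  [IsManifold (𝓡 n) ∞ M] [T2Space M]
  {A : Type*} [CommRing A] [Algebra ℝ A] [IsWeilAlgebra A]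

/-! ### Derivations of `C^∞(M)` along a near point -/

namespace NearPoint

theorem sum_apply (s : Finset (Fin n)) (Φ : Fin n → SmoothFn n M) (y : M) :
    (∑ i ∈ s, Φ i : SmoothFn n M) y = ∑ i ∈ s, Φ i y :=
  map_sum (ContMDiffMap.coeFnRingHom (I := 𝓡 n) (I' := 𝓘(ℝ, ℝ)) (N := M) (R := ℝ)
    (n := ∞) |>.toAddMonoidHom |> (Pi.evalAddMonoidHom _ y).comp) Φ s

/-- Smooth functions on `M` which agree near `x` with the coordinates of the chart `e`. -/
theorem exists_coord_extension {e : OpenPartialHomeomorph M (EuclideanSpace ℝ (Fin n))}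
    (he : e ∈ atlas (EuclideanSpace ℝ (Fin n)) M) {x : M} (hx : x ∈ e.source) :
    ∃ X : Fin n → SmoothFn n M, ∀ i, X i =ᶠ[𝓝 x] fun y => e y i := by
  choose X hX using fun i : Fin n => exists_extension (n := n)
    (eventually_contMDiffAt_coord he hx
      (h := fun y => y i) (EuclideanSpace.proj (𝕜 := ℝ) i).contDiff)
  exact ⟨X, hX⟩

/-- Hadamard's lemma in a chart of `M`, with globally defined factors. -/
theorem exists_hadamard_chart {e : OpenPartialHomeomorph M (EuclideanSpace ℝ (Fin n))}
    (he : e ∈ atlas (EuclideanSpace ℝ (Fin n)) M) {x : M} (hx : x ∈ e.source)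
    {X : Fin n → SmoothFn n M} (hX : ∀ i, X i =ᶠ[𝓝 x] fun y => e y i) (f : SmoothFn n M) :
    ∃ K : Fin n → SmoothFn n M, f =ᶠ[𝓝 x] (algebraMap ℝ (SmoothFn n M) (f x) +
      ∑ i, (X i - algebraMap ℝ (SmoothFn n M) (X i x)) * K i : SmoothFn n M) := by
  set c := e x with hc
  have hct : c ∈ e.target := e.map_source hx
  obtain ⟨g, hg, hgf⟩ : ∃ g : EuclideanSpace ℝ (Fin n) → ℝ, ContDiff ℝ ∞ g ∧
      g =ᶠ[𝓝 c] fun y => f (e.symm y) := by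
    obtain ⟨G, hG⟩ := exists_extension (n := n) (M := EuclideanSpace ℝ (Fin n))
      (f := fun y => f (e.symm y)) (x := c) (by
        filter_upwards [e.open_target.mem_nhds hct] with y hy
        exact ((contDiffOn_comp_symm he f).contDiffAt
          (e.open_target.mem_nhds hy)).contMDiffAt)
    exact ⟨G, G.contMDiff.contDiff, hG⟩
  obtain ⟨k, hk, hgk⟩ := exists_hadamard hg c
  choose K hK using fun i => exists_extension (n := n)
    (eventually_contMDiffAt_coord he hx (hk i))
  have hgc : g c = f x := by rw [hgf.eq_of_nhds, hc, e.left_inv hx]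
  refine ⟨K, ?_⟩
  have h1 : ∀ᶠ y in 𝓝 x, g (e y) = f (e.symm (e y)) :=
    (e.continuousAt hx).eventually hgf
  filter_upwards [h1, e.open_source.mem_nhds hx, Filter.eventually_all.2 hK,
    Filter.eventually_all.2 hX] with y h1 h2 h3 h4
  rw [e.left_inv h2, hgk, hgc] at h1
  rw [← h1, ContMDiffMap.coe_add, Pi.add_apply, sum_apply]
  congr 1
  refine Finset.sum_congr rfl fun i _ => ?_
  rw [ContMDiffMap.coe_mul, Pi.mul_apply, h3, ContMDiffMap.coe_sub, Pi.sub_apply, h4,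
    (hX i).eq_of_nhds]
  rfl

/-- `δ` is a derivation of `C^∞(M)` with values in `A`, where `A` is a `C^∞(M)`-module
through `ξ`: the tangent vectors of `M^A` at `ξ`. -/
def IsDerivationAt (ξ : NearPoint n M A) (δ : SmoothFn n M →ₗ[ℝ] A) : Prop :=
  ∀ f g, δ (f * g) = ξ.toHom f * δ g + ξ.toHom g * δ f

namespace IsDerivationAt

variable {ξ : NearPoint n M A} {δ δ' : SmoothFn n M →ₗ[ℝ] A}

theorem sub (h : IsDerivationAt ξ δ) (h' : IsDerivationAt ξ δ') : IsDerivationAt ξ (δ - δ') := by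
  intro f g
  simp only [LinearMap.sub_apply, h f g, h' f g]
  ring

theorem of_derivation (ξ : NearPoint n M A) (θ : Derivation ℝ (SmoothFn n M) (SmoothFn n M)) :
    IsDerivationAt ξ (ξ.toHom.toLinearMap ∘ₗ θ.toLinearMap) := by
  intro f g
  change ξ.toHom (θ (f * g)) = ξ.toHom f * ξ.toHom (θ g) + ξ.toHom g * ξ.toHom (θ f)
  rw [θ.leibniz, map_add, smul_eq_mul, smul_eq_mul, map_mul, map_mul]

theorem apply_one (h : IsDerivationAt ξ δ) : δ 1 = 0 := by
  have := h 1 1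
  rwa [mul_one, map_one ξ.toHom, one_mul, left_eq_add] at this

theorem apply_algebraMap (h : IsDerivationAt ξ δ) (r : ℝ) :
    δ (algebraMap ℝ (SmoothFn n M) r) = 0 := by
  rw [Algebra.algebraMap_eq_smul_one, map_smul, h.apply_one, smul_zero]

theorem eq_zero_of_eventuallyEq (h : IsDerivationAt ξ δ) {f : SmoothFn n M}
    (hf : f =ᶠ[𝓝 ξ.base] 0) : δ f = 0 := by
  obtain ⟨F, h1, h2⟩ := exists_bump (n := n) hf
  have hF : f * F = 0 := by
    ext y
    by_cases hy : f y = 0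
    · simp [hy]
    · simp [h2 y hy]
  have hu : IsUnit (ξ.toHom F) := by
    by_contra h
    have := (realPart_eq_zero_iff _).2 ((IsLocalRing.mem_maximalIdeal _).2 h)
    rw [realPart_toHom, h1] at this
    exact one_ne_zero this
  have := h f F
  rw [hF, map_zero, ξ.toHom_eq_zero hf, zero_mul, zero_add] at this
  exact hu.mul_right_eq_zero.1 this.symm

theorem congr (h : IsDerivationAt ξ δ) {f g : SmoothFn n M} (hfg : f =ᶠ[𝓝 ξ.base] g) :
    δ f = δ g := by
  rw [← sub_eq_zero, ← map_sub]
  apply h.eq_zero_of_eventuallyEq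
  filter_upwards [hfg] with y hy
  simp [hy]

/-- A derivation along `ξ` is determined by its values on local coordinates: by Hadamard's lemma,
a derivation which vanishes on them takes its values in all powers of `𝔪`. -/
theorem eq_zero_of_coord (h : IsDerivationAt ξ δ)
    {e : OpenPartialHomeomorph M (EuclideanSpace ℝ (Fin n))}
    (he : e ∈ atlas (EuclideanSpace ℝ (Fin n)) M) (hξ : ξ.base ∈ e.source)
    {X : Fin n → SmoothFn n M} (hX : ∀ i, X i =ᶠ[𝓝 ξ.base] fun y => e y i)
    (hδ : ∀ i, δ (X i) = 0) : δ = 0 := by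
  have key : ∀ N : ℕ, ∀ f : SmoothFn n M, δ f ∈ IsLocalRing.maximalIdeal A ^ N := by
    intro N
    induction N with
    | zero => intro f; simp
    | succ N ih =>
      intro f
      obtain ⟨K, hK⟩ := exists_hadamard_chart he hξ hX f
      rw [h.congr hK, map_add, h.apply_algebraMap, zero_add, map_sum]
      refine Ideal.sum_mem _ fun i _ => ?_
      rw [h, map_sub δ, h.apply_algebraMap, hδ, sub_zero, mul_zero, add_zero, pow_succ']
      refine Ideal.mul_mem_mul ?_ (ih (K i))
      rw [map_sub, AlgHom.commutes]
      exact ξ.sub_mem (X i)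
  exact LinearMap.ext fun f => eq_zero_of_mem_pow (key _ f)

end IsDerivationAt

/-! ### Smooth functions in the charts of `M^A` -/

variable {e : OpenPartialHomeomorph M (EuclideanSpace ℝ (Fin n))}
  (he : e ∈ atlas (EuclideanSpace ℝ (Fin n)) M)

theorem chart_mem_core_atlas : chart e he ∈ (core n M A).atlas := ⟨e, he, rfl⟩

theorem homeomorph_mem_maximalAtlas :
    (core n M A).openPartialHomeomorph (chart e he) (chart_mem_core_atlas he) ∈
      IsManifold.maximalAtlas 𝓘(ℝ, Model n A) ∞ (NearPoint n M A) := by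
  apply IsManifold.subset_maximalAtlas
  change _ ∈ ⋃ (ψ) (h : ψ ∈ (core n M A).atlas), {(core n M A).openPartialHomeomorph ψ h}
  simp only [Set.mem_iUnion, Set.mem_singleton_iff]
  exact ⟨_, chart_mem_core_atlas he, rfl⟩

theorem isOpen_chart_source : IsOpen (chart (A := A) e he).source :=
  ((core n M A).openPartialHomeomorph (chart e he) (chart_mem_core_atlas he)).open_source

theorem isOpen_center_preimage {V : Set (EuclideanSpace ℝ (Fin n))} (hV : IsOpen V) :
    IsOpen (center (A := A) ⁻¹' V) :=
  hV.preimage contDiff_center.continuous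

theorem center_chart {ξ : NearPoint n M A} (hξ : ξ.base ∈ e.source) :
    center (chart e he ξ) = e ξ.base := by
  have h1 := congrArg base ((chart e he).left_inv hξ)
  have h2 : center (chart e he ξ) ∈ e.target := (chart e he).map_source hξ
  rw [← e.right_inv h2]
  exact congrArg e ((base_ofCoord he _).symm.trans h1)

theorem toVec_chart (ξ : NearPoint n M A) (i : Fin n) {X : SmoothFn n M}
    (hX : X =ᶠ[𝓝 ξ.base] fun y => e y i) : toVec (chart e he ξ) i = ξ.toHom X := by
  rw [← ξ.germEval_eq hX]
  exact congrFun (toVec_ofVec _) i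

theorem ofCoord_chart {ξ : NearPoint n M A} (hξ : ξ.base ∈ e.source) :
    ofCoord e he (chart e he ξ) = ξ :=
  (chart e he).left_inv hξ

theorem eventually_base_ofCoord {ξ : NearPoint n M A} (hξ : ξ.base ∈ e.source) {p : M → Prop}
    (hp : ∀ᶠ y in 𝓝 ξ.base, p y) :
    ∀ᶠ w in 𝓝 (chart e he ξ), center w ∈ e.target ∧ p (ofCoord e he w).base := by
  have hw : center (chart e he ξ) ∈ e.target := (chart e he).map_source hξ
  rw [← e.left_inv hξ, ← center_chart he hξ] at hp
  have h := ((e.symm.continuousAt hw).comp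
    (contDiff_center (A := A)).continuous.continuousAt).eventually hp
  filter_upwards [h, (isOpen_center_preimage e.open_target).mem_nhds hw] with w h4 h5
  exact ⟨h5, (base_ofCoord he w).symm ▸ h4⟩

theorem contDiffOn_comp_ofCoord {ψ : NearPoint n M A → ℝ}
    (hψ : ContMDiff 𝓘(ℝ, Model n A) 𝓘(ℝ, ℝ) ∞ ψ) :
    ContDiffOn ℝ ∞ (fun w => ψ (ofCoord e he w)) (center ⁻¹' e.target) := by
  rw [← contMDiffOn_iff_contDiffOn]
  exact hψ.comp_contMDiffOn (contMDiffOn_symm_of_mem_maximalAtlas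
    (homeomorph_mem_maximalAtlas (A := A) he))

theorem contMDiffAt_of_comp_ofCoord {ψ : NearPoint n M A → ℝ} {ξ : NearPoint n M A}
    (hξ : ξ.base ∈ e.source)
    (hψ : ContDiffAt ℝ ∞ (fun w => ψ (ofCoord e he w)) (chart e he ξ)) :
    ContMDiffAt 𝓘(ℝ, Model n A) 𝓘(ℝ, ℝ) ∞ ψ ξ := by
  have h1 : ContMDiffAt 𝓘(ℝ, Model n A) 𝓘(ℝ, Model n A) ∞ (chart e he) ξ :=
    contMDiffAt_of_mem_maximalAtlas (homeomorph_mem_maximalAtlas (A := A) he) hξ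
  refine (hψ.contMDiffAt.comp ξ h1).congr_of_eventuallyEq ?_
  filter_upwards [(isOpen_chart_source he).mem_nhds hξ] with η hη
  exact congrArg ψ (ofCoord_chart he hη).symm

end NearPoint

/-! ### Directional derivatives of `A`-valued functions -/

section DirDeriv

variable {E : Type*} [NormedAddCommGroup E] [NormedSpace ℝ E]

/-- The derivative of `Φ : E → A` at `w` in the direction `v`, computed in the coordinates with
respect to a basis of the real vector space `A`. -/
noncomputable def dirDeriv (Φ : E → A) (w v : E) : A :=
  ∑ j, fderiv ℝ (fun y => (Module.finBasis ℝ A).coord j (Φ y)) w v • Module.finBasis ℝ A j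

/-- `Φ : E → A` is differentiable at `w`, where `A` is regarded as a finite-dimensional real
vector space. -/
def DiffAt (Φ : E → A) (w : E) : Prop :=
  ∀ ℓ : A →ₗ[ℝ] ℝ, DifferentiableAt ℝ (fun y => ℓ (Φ y)) w

variable {Φ Ψ : E → A} {w v : E}

theorem linearMap_eq_sum_coord (ℓ : A →ₗ[ℝ] ℝ) (a : A) :
    ℓ a = ∑ j, ℓ (Module.finBasis ℝ A j) * (Module.finBasis ℝ A).coord j a := by
  conv_lhs => rw [← (Module.finBasis ℝ A).sum_repr a]
  rw [map_sum]
  refine Finset.sum_congr rfl fun j _ => ?_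
  rw [map_smul, smul_eq_mul, mul_comm]
  rfl

theorem ext_linearMap {a b : A} (h : ∀ ℓ : A →ₗ[ℝ] ℝ, ℓ a = ℓ b) : a = b :=
  (Module.finBasis ℝ A).ext_elem fun j => h ((Module.finBasis ℝ A).coord j)

theorem apply_dirDeriv (hΦ : DiffAt Φ w) (ℓ : A →ₗ[ℝ] ℝ) :
    ℓ (dirDeriv Φ w v) = fderiv ℝ (fun y => ℓ (Φ y)) w v := by
  have h : (fun y => ℓ (Φ y)) = fun y => ∑ j, ℓ (Module.finBasis ℝ A j) *
      (Module.finBasis ℝ A).coord j (Φ y) := funext fun y => linearMap_eq_sum_coord ℓ _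
  rw [h, fderiv_fun_sum fun j _ => (hΦ _).const_mul _, sum_apply, dirDeriv,
    map_sum]
  refine Finset.sum_congr rfl fun j _ => ?_
  rw [fderiv_const_mul (hΦ _), map_smul, smul_apply, smul_eq_mul, smul_eq_mul,
    mul_comm]

theorem dirDeriv_congr (h : Φ =ᶠ[𝓝 w] Ψ) : dirDeriv Φ w v = dirDeriv Ψ w v := by
  refine Finset.sum_congr rfl fun j _ => ?_
  have : (fun y => (Module.finBasis ℝ A).coord j (Φ y)) =ᶠ[𝓝 w]
      fun y => (Module.finBasis ℝ A).coord j (Ψ y) := by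
    filter_upwards [h] with y hy
    rw [hy]
  rw [this.fderiv_eq]

theorem dirDeriv_add (hΦ : DiffAt Φ w) (hΨ : DiffAt Ψ w) :
    dirDeriv (fun y => Φ y + Ψ y) w v = dirDeriv Φ w v + dirDeriv Ψ w v := by
  simp only [dirDeriv, map_add, ← Finset.sum_add_distrib]
  refine Finset.sum_congr rfl fun j _ => ?_
  rw [fderiv_fun_add (hΦ _) (hΨ _), add_apply, add_smul]

theorem dirDeriv_const_mul (a : A) (hΦ : DiffAt Φ w) :
    dirDeriv (fun y => a * Φ y) w v = a * dirDeriv Φ w v := by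
  refine ext_linearMap fun ℓ => ?_
  have h1 : DiffAt (fun y => a * Φ y) w := fun ℓ => hΦ (ℓ ∘ₗ LinearMap.mulLeft ℝ a)
  rw [apply_dirDeriv h1]
  exact (apply_dirDeriv hΦ (ℓ ∘ₗ LinearMap.mulLeft ℝ a)).symm

theorem apply_mul_eq_sum (ℓ : A →ₗ[ℝ] ℝ) (a b : A) :
    ℓ (a * b) = ∑ j, (Module.finBasis ℝ A).coord j a *
      (ℓ ∘ₗ LinearMap.mulLeft ℝ (Module.finBasis ℝ A j)) b := by
  rw [← LinearMap.mulRight_apply (R := ℝ) b a, ← LinearMap.comp_apply, linearMap_eq_sum_coord]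
  refine Finset.sum_congr rfl fun j _ => ?_
  rw [mul_comm]
  rfl

theorem DiffAt.mul (hΦ : DiffAt Φ w) (hΨ : DiffAt Ψ w) : DiffAt (fun y => Φ y * Ψ y) w := by
  intro ℓ
  simp only [apply_mul_eq_sum ℓ]
  exact DifferentiableAt.fun_sum fun j _ => (hΦ _).fun_mul (hΨ _)

theorem dirDeriv_mul (hΦ : DiffAt Φ w) (hΨ : DiffAt Ψ w) :
    dirDeriv (fun y => Φ y * Ψ y) w v = Φ w * dirDeriv Ψ w v + Ψ w * dirDeriv Φ w v := by
  refine ext_linearMap fun ℓ => ?_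
  rw [apply_dirDeriv (hΦ.mul hΨ), map_add, mul_comm (Ψ w)]
  simp only [apply_mul_eq_sum ℓ]
  rw [fderiv_fun_sum fun j _ => (hΦ _).fun_mul (hΨ _), sum_apply,
    ← Finset.sum_add_distrib]
  refine Finset.sum_congr rfl fun j _ => ?_
  rw [fderiv_fun_mul (hΦ _) (hΨ _), apply_dirDeriv hΨ, apply_dirDeriv hΦ]
  simp only [add_apply, smul_apply, smul_eq_mul]
  ring

theorem dirDeriv_smul_const {ψ : E → ℝ} (hψ : DifferentiableAt ℝ ψ w) (a : A) :
    dirDeriv (fun y => ψ y • a) w v = fderiv ℝ ψ w v • a := by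
  refine ext_linearMap fun ℓ => ?_
  have h : DiffAt (fun y => ψ y • a) w := fun ℓ => by
    simp only [map_smul, smul_eq_mul]
    exact hψ.mul_const _
  rw [apply_dirDeriv h]
  simp only [map_smul, smul_eq_mul]
  rw [fderiv_mul_const hψ, smul_apply, smul_eq_mul, mul_comm]

theorem fderiv_toVec (ℓ : A →ₗ[ℝ] ℝ) (i : Fin n) (w v : Model n A) :
    fderiv ℝ (fun w : Model n A => ℓ (toVec w i)) w v = ℓ (toVec v i) := by
  let L : Model n A →ₗ[ℝ] ℝ :=
    ℓ ∘ₗ (Module.finBasis ℝ A).equivFun.symm.toLinearMap ∘ₗ LinearMap.proj i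
  have h : HasFDerivAt (fun w : Model n A => ℓ (toVec w i)) (LinearMap.toContinuousLinearMap L) w :=
    (LinearMap.toContinuousLinearMap L).hasFDerivAt
  rw [h.fderiv]
  rfl

end DirDeriv

/-! ### The prolongation of a vector field, near point by near point -/

namespace NearPoint

variable {e e' : OpenPartialHomeomorph M (EuclideanSpace ℝ (Fin n))}
  (he : e ∈ atlas (EuclideanSpace ℝ (Fin n)) M) (he' : e' ∈ atlas (EuclideanSpace ℝ (Fin n)) M)
  (θ : Derivation ℝ (SmoothFn n M) (SmoothFn n M))

open Classical in
/-- The value `ξ(θ(F))` for any smooth function `F` on `M` with the same germ as `f` at the origin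
of `ξ` (and `0` if there is none). -/
noncomputable def germDeriv (ξ : NearPoint n M A) (f : M → ℝ) : A :=
  if h : ∃ F : SmoothFn n M, F =ᶠ[𝓝 ξ.base] f then ξ.toHom (θ h.choose) else 0

theorem germDeriv_eq (ξ : NearPoint n M A) {f : M → ℝ} {F : SmoothFn n M}
    (hF : F =ᶠ[𝓝 ξ.base] f) : ξ.germDeriv θ f = ξ.toHom (θ F) := by
  have h : ∃ F : SmoothFn n M, F =ᶠ[𝓝 ξ.base] f := ⟨F, hF⟩
  rw [germDeriv, dif_pos h]
  exact (IsDerivationAt.of_derivation ξ θ).congr (h.choose_spec.trans hF.symm)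

/-- The coordinates `(ξ(θ(x₁)), …, ξ(θ(xₙ))) ∈ Aⁿ` of the tangent vector `θ^A(ξ)` in the chart `e`
with coordinate functions `x₁, …, xₙ`. -/
noncomputable def prolongVec (e : OpenPartialHomeomorph M (EuclideanSpace ℝ (Fin n)))
    (ξ : NearPoint n M A) : Model n A :=
  ofVec fun i => ξ.germDeriv θ fun y => e y i

/-- The derivative of `φ : M^A → A` at `ξ` along `θ^A`, computed in the chart `e`. -/
noncomputable def prolongAt (φ : NearPoint n M A → A) (ξ : NearPoint n M A) : A :=
  dirDeriv (fun w => φ (ofCoord e he w)) (chart e he ξ) (prolongVec θ e ξ)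

theorem diffAt_comp_ofCoord (φ : smoothFnA n M A) {w : Model n A} (hw : center w ∈ e.target) :
    DiffAt (fun w => (φ : NearPoint n M A → A) (ofCoord e he w)) w := fun ℓ =>
  ((contDiffOn_comp_ofCoord he (φ.2 ℓ)).contDiffAt
    ((isOpen_center_preimage e.open_target).mem_nhds hw)).differentiableAt (by simp)

theorem diffAt_comp_ofCoord_chart (φ : smoothFnA n M A) {ξ : NearPoint n M A}
    (hξ : ξ.base ∈ e.source) :
    DiffAt (fun w => (φ : NearPoint n M A → A) (ofCoord e he w)) (chart e he ξ) :=
  diffAt_comp_ofCoord he φ ((chart e he).map_source hξ)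

theorem prolongAt_add (φ ψ : smoothFnA n M A) {ξ : NearPoint n M A} (hξ : ξ.base ∈ e.source) :
    prolongAt he θ (φ + ψ : NearPoint n M A → A) ξ =
      prolongAt he θ φ ξ + prolongAt he θ ψ ξ :=
  dirDeriv_add (diffAt_comp_ofCoord_chart he φ hξ) (diffAt_comp_ofCoord_chart he ψ hξ)

theorem prolongAt_smul (a : A) (φ : smoothFnA n M A) {ξ : NearPoint n M A}
    (hξ : ξ.base ∈ e.source) :
    prolongAt he θ (a • φ : NearPoint n M A → A) ξ = a * prolongAt he θ φ ξ :=
  dirDeriv_const_mul a (diffAt_comp_ofCoord_chart he φ hξ)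

theorem prolongAt_mul (φ ψ : smoothFnA n M A) {ξ : NearPoint n M A} (hξ : ξ.base ∈ e.source) :
    prolongAt he θ (φ * ψ : NearPoint n M A → A) ξ =
      φ.1 ξ * prolongAt he θ ψ ξ + ψ.1 ξ * prolongAt he θ φ ξ := by
  have h := dirDeriv_mul (v := prolongVec θ e ξ) (diffAt_comp_ofCoord_chart he φ hξ)
    (diffAt_comp_ofCoord_chart he ψ hξ)
  simp only [ofCoord_chart he hξ] at h
  exact h

/-- In every chart around the origin of `ξ`, the derivative of `f^A` along `θ^A` is `ξ(θ(f))`: both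
sides are derivations along `ξ` which agree on the coordinate functions. -/
theorem prolongAt_prolongFn (f : SmoothFn n M) {ξ : NearPoint n M A} (hξ : ξ.base ∈ e.source) :
    prolongAt he θ (prolongFn A f) ξ = ξ.toHom (θ f) := by
  let δ : SmoothFn n M →ₗ[ℝ] A :=
    { toFun := fun f => prolongAt he θ (prolongFn A f) ξ
      map_add' := fun f g => by
        rw [← prolongAt_add he θ _ _ hξ]
        congr 1
        funext η
        exact map_add η.toHom f g
      map_smul' := fun r f => by
        rw [RingHom.id_apply, Algebra.smul_def (A := A), ← prolongAt_smul he θ _ _ hξ]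
        congr 1
        funext η
        exact (map_smul η.toHom r f).trans (Algebra.smul_def _ _) }
  have hδ : IsDerivationAt ξ δ := fun f g => by
    refine Eq.trans ?_ (prolongAt_mul he θ (prolongFn A f) (prolongFn A g) hξ)
    change prolongAt he θ (prolongFn A (f * g)) ξ = _
    congr 1
    funext η
    exact map_mul η.toHom f g
  obtain ⟨X, hX⟩ := exists_coord_extension he hξ
  have hsub := hδ.sub (IsDerivationAt.of_derivation ξ θ)
  have h0 := hsub.eq_zero_of_coord he hξ hX fun i => ?_
  · exact sub_eq_zero.1 (LinearMap.congr_fun h0 f)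
  · change prolongAt he θ (prolongFn A (X i)) ξ - ξ.toHom (θ (X i)) = 0
    rw [sub_eq_zero, ← germDeriv_eq θ ξ (hX i)]
    -- near `ξ`, the function `X i ^ A` is the coordinate `w ↦ toVec w i`
    have h1 : (fun w => (prolongFn A (X i) : NearPoint n M A → A) (ofCoord e he w))
        =ᶠ[𝓝 (chart e he ξ)] fun w => toVec w i := by
      filter_upwards [eventually_base_ofCoord he hξ (hX i).eventuallyEq_nhds] with w h
      refine (toVec_chart he _ i h.2).symm.trans ?_
      exact congrArg (toVec · i) ((chart e he).right_inv h.1)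
    rw [prolongAt, dirDeriv_congr h1]
    refine ext_linearMap fun ℓ => ?_
    rw [apply_dirDeriv fun ℓ => (contDiff_toVec ℓ i).contDiffAt.differentiableAt (by simp)]
    rw [fderiv_toVec]
    exact congrArg ℓ (congrFun (toVec_ofVec _) i)

theorem prolongAt_chart_indep (φ : smoothFnA n M A) {ξ : NearPoint n M A} (hξ : ξ.base ∈ e.source)
    (hξ' : ξ.base ∈ e'.source) : prolongAt he θ φ ξ = prolongAt he' θ φ ξ := by
  have hw : center (chart e he ξ) ∈ e.target := (chart e he).map_source hξ
  set T : Model n A → Model n A := fun w => chart e' he' (ofCoord e he w) with hT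
  have hsrc : ((chart (A := A) e he).symm.trans (chart e' he')).source ∈ 𝓝 (chart e he ξ) := by
    rw [source_symm_trans_chart]
    refine (isOpen_center_preimage (e.symm.trans e').open_source).mem_nhds ?_
    have h1 : e.symm (center (chart e he ξ)) = ξ.base := by
      rw [center_chart he hξ, e.left_inv hξ]
    simpa [h1] using ⟨hw, hξ'⟩
  have hTd : DifferentiableAt ℝ T (chart e he ξ) :=
    ((contDiffOn_symm_trans_chart he he').contDiffAt hsrc).differentiableAt (by simp)
  have hTw : T (chart e he ξ) = chart e' he' ξ := by rw [hT]; simp only [ofCoord_chart he hξ]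
  -- the change of charts maps the coordinates of `θ^A(ξ)` in `e` to those in `e'`
  have hTv : fderiv ℝ T (chart e he ξ) (prolongVec θ e ξ) = prolongVec θ e' ξ := by
    obtain ⟨X, hX⟩ := exists_coord_extension he' hξ'
    funext i j
    have h1 : (fun w => T w i j) =ᶠ[𝓝 (chart e he ξ)] fun w =>
        (Module.finBasis ℝ A).coord j ((prolongFn A (X i)).1 (ofCoord e he w)) := by
      filter_upwards [eventually_base_ofCoord he hξ (hX i).eventuallyEq_nhds] with w h
      rw [← ofVec_toVec (T w)]
      exact congrArg ((Module.finBasis ℝ A).coord j) (toVec_chart he' _ i h.2)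
    have h2 : fderiv ℝ T (chart e he ξ) (prolongVec θ e ξ) i j =
        fderiv ℝ (fun w => T w i j) (chart e he ξ) (prolongVec θ e ξ) := by
      have h3 := hasFDerivAt_pi'.1 (hasFDerivAt_pi'.1 hTd.hasFDerivAt i) j
      exact (congrArg (fun L : Model n A →L[ℝ] ℝ => L (prolongVec θ e ξ)) h3.fderiv).symm
    rw [h2, h1.fderiv_eq, ← apply_dirDeriv (diffAt_comp_ofCoord_chart he _ hξ)]
    refine congrArg ((Module.finBasis ℝ A).coord j) ?_
    exact (prolongAt_prolongFn he θ (X i) hξ).trans (germDeriv_eq θ ξ (hX i)).symm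
  refine ext_linearMap fun ℓ => ?_
  have hφ' := diffAt_comp_ofCoord_chart he' φ hξ'
  rw [prolongAt, apply_dirDeriv (diffAt_comp_ofCoord_chart he φ hξ), prolongAt,
    apply_dirDeriv hφ', ← hTv]
  have h2 : (fun w => ℓ (φ.1 (ofCoord e he w))) =ᶠ[𝓝 (chart e he ξ)]
      (fun w => ℓ (φ.1 (ofCoord e' he' w))) ∘ T := by
    filter_upwards [hsrc] with w hw
    exact congrArg (fun η => ℓ (φ.1 η)) (ofCoord_chart (A := A) he' hw.2).symm
  rw [h2.fderiv_eq, fderiv_comp _ (by rw [hTw]; exact hφ' ℓ) hTd, hTw]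
  rfl

end NearPoint

/-! ### Existence of the prolongation -/

/-- The derivative of `φ : M^A → A` along `θ^A`, at each near point computed in the preferred chart
around its origin. -/
noncomputable def prolongFun (θ : Derivation ℝ (SmoothFn n M) (SmoothFn n M))
    (φ : NearPoint n M A → A) (ξ : NearPoint n M A) : A :=
  NearPoint.prolongAt (chart_mem_atlas (EuclideanSpace ℝ (Fin n)) ξ.base) θ φ ξ

theorem prolongFun_mem (θ : Derivation ℝ (SmoothFn n M) (SmoothFn n M)) (φ : smoothFnA n M A) :
    prolongFun θ φ ∈ smoothFnA n M A := by
  change ∀ ℓ : A →ₗ[ℝ] ℝ, ContMDiff 𝓘(ℝ, Model n A) 𝓘(ℝ, ℝ) ∞ fun ξ => ℓ (prolongFun θ φ ξ)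
  intro ℓ ξ
  set e := chartAt (EuclideanSpace ℝ (Fin n)) ξ.base with hedef
  have he : e ∈ atlas (EuclideanSpace ℝ (Fin n)) M := chart_mem_atlas _ _
  have hξ : ξ.base ∈ e.source := mem_chart_source _ _
  obtain ⟨X, hX⟩ := NearPoint.exists_coord_extension he hξ
  refine NearPoint.contMDiffAt_of_comp_ofCoord he hξ ?_
  have hw : center (NearPoint.chart e he ξ) ∈ e.target := (NearPoint.chart e he).map_source hξ
  have hV := NearPoint.isOpen_center_preimage (A := A) e.open_target
  -- near `ξ`, the chart `e` and the extensions `X i` of its coordinates can be used throughout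
  have h1 : (fun w => ℓ (prolongFun θ φ (NearPoint.ofCoord e he w)))
      =ᶠ[𝓝 (NearPoint.chart e he ξ)] fun w =>
        fderiv ℝ (fun w => ℓ (φ.1 (NearPoint.ofCoord e he w))) w
          (ofVec fun i => (prolongFn A (θ (X i))).1 (NearPoint.ofCoord e he w)) := by
    filter_upwards [NearPoint.eventually_base_ofCoord he hξ
      (Filter.eventually_all.2 fun i => (hX i).eventuallyEq_nhds)] with w h
    have h2 : (NearPoint.ofCoord e he w).base ∈ e.source := (NearPoint.chart e he).map_target h.1
    rw [prolongFun, NearPoint.prolongAt_chart_indep _ he θ φ (mem_chart_source _ _) h2,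
      NearPoint.prolongAt, apply_dirDeriv (NearPoint.diffAt_comp_ofCoord_chart he φ h2)]
    have h3 : NearPoint.chart e he (NearPoint.ofCoord e he w) = w :=
      (NearPoint.chart e he).right_inv h.1
    have h4 : NearPoint.prolongVec θ e (NearPoint.ofCoord e he w) =
        ofVec fun i => (prolongFn A (θ (X i))).1 (NearPoint.ofCoord e he w) :=
      congrArg ofVec (funext fun i => NearPoint.germDeriv_eq θ _ (h.2 i))
    rw [h3, h4]
  refine ContDiffAt.congr_of_eventuallyEq ?_ h1
  refine ContDiffAt.clm_apply (((NearPoint.contDiffOn_comp_ofCoord he (φ.2 ℓ)).fderiv_of_isOpen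
    (m := ∞) hV (by simp)).contDiffAt (hV.mem_nhds hw)) ?_
  refine contDiffAt_pi.2 fun i => contDiffAt_pi.2 fun j => ?_
  exact (NearPoint.contDiffOn_comp_ofCoord he ((prolongFn A (θ (X i))).2
    ((Module.finBasis ℝ A).coord j))).contDiffAt (hV.mem_nhds hw)

/-- The derivation of `C^∞(M^A, A)` given by the derivative along `θ^A`. -/
noncomputable def prolongDerivation (θ : Derivation ℝ (SmoothFn n M) (SmoothFn n M)) :
    Derivation A (smoothFnA n M A) (smoothFnA n M A) :=
  Derivation.mk'
    { toFun := fun φ => ⟨prolongFun θ φ, prolongFun_mem θ φ⟩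
      map_add' := fun φ ψ => Subtype.ext <| funext fun _ =>
        NearPoint.prolongAt_add _ θ φ ψ (mem_chart_source _ _)
      map_smul' := fun a φ => Subtype.ext <| funext fun _ =>
        NearPoint.prolongAt_smul _ θ a φ (mem_chart_source _ _) }
    fun φ ψ => Subtype.ext <| funext fun _ =>
      NearPoint.prolongAt_mul _ θ φ ψ (mem_chart_source _ _)

theorem isProlongation_prolongDerivation (θ : Derivation ℝ (SmoothFn n M) (SmoothFn n M)) :
    IsProlongation θ (prolongDerivation (A := A) θ) := by
  refine ⟨fun φ hφ ξ => ?_, fun f => Subtype.ext <| funext fun _ =>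
    NearPoint.prolongAt_prolongFn _ θ f (mem_chart_source _ _)⟩
  set e := chartAt (EuclideanSpace ℝ (Fin n)) ξ.base with hedef
  have he : e ∈ atlas (EuclideanSpace ℝ (Fin n)) M := chart_mem_atlas _ _
  have hξ : ξ.base ∈ e.source := mem_chart_source _ _
  have h1 : (fun w => φ.1 (NearPoint.ofCoord e he w)) =
      fun w => realPart A (φ.1 (NearPoint.ofCoord e he w)) • (1 : A) := by
    funext w
    obtain ⟨r, hr⟩ := hφ (NearPoint.ofCoord e he w)
    rw [hr, realPart_algebraMap, Algebra.algebraMap_eq_smul_one]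
  have h2 := dirDeriv_smul_const (v := NearPoint.prolongVec θ e ξ)
    (NearPoint.diffAt_comp_ofCoord_chart he φ hξ (realPart A).toLinearMap) (1 : A)
  refine ⟨_, Eq.trans ?_ (h2.trans (Algebra.algebraMap_eq_smul_one _).symm)⟩
  exact congrArg (fun Φ => dirDeriv Φ (NearPoint.chart e he ξ) (NearPoint.prolongVec θ e ξ)) h1

/-! ### Uniqueness of the prolongation -/

variable (n M A) in
/-- The algebra `C^∞(M^A)`. -/
abbrev SmoothFnNear : Type _ := C^∞⟮𝓘(ℝ, Model n A), NearPoint n M A; ℝ⟯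

/-- The inclusion `C^∞(M^A) ⊆ C^∞(M^A, A)`. -/
noncomputable def ofReal : SmoothFnNear n M A →+* smoothFnA n M A where
  toFun ψ := ⟨fun ξ => algebraMap ℝ A (ψ ξ), by
    change ∀ ℓ : A →ₗ[ℝ] ℝ, ContMDiff 𝓘(ℝ, Model n A) 𝓘(ℝ, ℝ) ∞
      fun ξ : NearPoint n M A => ℓ (algebraMap ℝ A (ψ ξ))
    intro ℓ
    simp only [Algebra.algebraMap_eq_smul_one, map_smul, smul_eq_mul]
    exact ψ.contMDiff.mul contMDiff_const⟩
  map_one' := Subtype.ext <| funext fun _ => map_one (algebraMap ℝ A)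
  map_zero' := Subtype.ext <| funext fun _ => map_zero (algebraMap ℝ A)
  map_mul' _ _ := Subtype.ext <| funext fun _ => map_mul (algebraMap ℝ A) _ _
  map_add' _ _ := Subtype.ext <| funext fun _ => map_add (algebraMap ℝ A) _ _

theorem isRealValued_ofReal (ψ : SmoothFnNear n M A) : IsRealValued (ofReal ψ) :=
  fun ξ => ⟨ψ ξ, rfl⟩

/-- The composition of `φ ∈ C^∞(M^A, A)` with a linear form on `A`. -/
noncomputable def component (ℓ : A →ₗ[ℝ] ℝ) (φ : smoothFnA n M A) : SmoothFnNear n M A :=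
  ⟨fun ξ => ℓ (φ.1 ξ), φ.2 ℓ⟩

theorem smoothFnA_sum_apply {ι : Type*} (s : Finset ι) (Φ : ι → smoothFnA n M A)
    (ξ : NearPoint n M A) : (∑ j ∈ s, Φ j : smoothFnA n M A).1 ξ = ∑ j ∈ s, (Φ j).1 ξ := by
  rw [← Finset.sum_apply]
  exact congrFun (map_sum (smoothFnA n M A).val Φ s) ξ

theorem eq_sum_component (φ : smoothFnA n M A) :
    φ = ∑ j, Module.finBasis ℝ A j • ofReal (component ((Module.finBasis ℝ A).coord j) φ) := by
  refine Subtype.ext <| funext fun ξ => ?_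
  rw [smoothFnA_sum_apply]
  conv_lhs => rw [← (Module.finBasis ℝ A).sum_repr (φ.1 ξ)]
  refine Finset.sum_congr rfl fun j _ => ?_
  rw [Algebra.smul_def, mul_comm]
  rfl

theorem ofReal_component (ℓ : A →ₗ[ℝ] ℝ) (φ : smoothFnA n M A) :
    ofReal (component ℓ φ) = ∑ j, algebraMap ℝ A (ℓ (Module.finBasis ℝ A j)) •
      ofReal (component ((Module.finBasis ℝ A).coord j) φ) := by
  refine Subtype.ext <| funext fun ξ => ?_
  rw [smoothFnA_sum_apply]
  change algebraMap ℝ A (ℓ (φ.1 ξ)) = _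
  rw [linearMap_eq_sum_coord, map_sum]
  exact Finset.sum_congr rfl fun j _ => map_mul _ _ _

/-- Since a vector field preserves real-valued functions, one that kills `φ` also kills the
components of `φ`. -/
theorem IsVectorField.apply_component_eq_zero
    {D : Derivation A (smoothFnA n M A) (smoothFnA n M A)} (hD : IsVectorField D)
    {φ : smoothFnA n M A} (hφ : D φ = 0) (ℓ : A →ₗ[ℝ] ℝ) : D (ofReal (component ℓ φ)) = 0 := by
  have key : ∀ j, D (ofReal (component ((Module.finBasis ℝ A).coord j) φ)) = 0 := by
    choose r hr using fun j => hD _ (isRealValued_ofReal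
      (component ((Module.finBasis ℝ A).coord j) φ))
    have h1 : ∀ ξ, ∑ j, r j ξ • Module.finBasis ℝ A j = 0 := by
      intro ξ
      have h2 := congrArg (fun ψ : smoothFnA n M A => ψ.1 ξ) hφ
      change (D φ).1 ξ = 0 at h2
      rw [eq_sum_component φ, map_sum, smoothFnA_sum_apply] at h2
      refine Eq.trans (Finset.sum_congr rfl fun j _ => ?_) h2
      rw [D.map_smul, Algebra.smul_def, mul_comm, ← hr]
      rfl
    intro j
    refine Subtype.ext <| funext fun ξ => ?_
    rw [hr, Fintype.linearIndependent_iff.1 (Module.finBasis ℝ A).linearIndependent _ (h1 ξ) j,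
      map_zero]
    rfl
  rw [ofReal_component, map_sum]
  exact Finset.sum_eq_zero fun j _ => by rw [D.map_smul, key, smul_zero]

/-- Hadamard's lemma on a finite-dimensional space. -/
theorem exists_hadamard_finiteDimensional {E : Type*} [NormedAddCommGroup E] [NormedSpace ℝ E]
    [FiniteDimensional ℝ E] {g : E → ℝ} (hg : ContDiff ℝ ∞ g) (c : E) :
    ∃ (m : ℕ) (lam : Fin m → E →ₗ[ℝ] ℝ) (h : Fin m → E → ℝ), (∀ k, ContDiff ℝ ∞ (h k)) ∧
      ∀ y, g y = g c + ∑ k, (lam k y - lam k c) * h k y := by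
  let L : E ≃L[ℝ] EuclideanSpace ℝ (Fin (Module.finrank ℝ E)) := toEuclidean
  obtain ⟨h, hh, hgh⟩ := exists_hadamard (g := g ∘ L.symm) (hg.comp L.symm.contDiff) (L c)
  refine ⟨_, fun k => (EuclideanSpace.proj (𝕜 := ℝ) k).toLinearMap ∘ₗ L.toLinearEquiv.toLinearMap,
    fun k y => h k (L y), fun k => (hh k).comp L.contDiff, fun y => ?_⟩
  have h1 := hgh (L y)
  simp only [Function.comp_apply, L.symm_apply_apply] at h1
  exact h1

/-- The smooth map `M^A → Aⁿ` with components `X₁^A, …, Xₙ^A`. -/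
noncomputable def coordMap (X : Fin n → SmoothFn n M) (ξ : NearPoint n M A) : Model n A :=
  ofVec fun i => ξ.toHom (X i)

theorem contMDiff_coordMap (X : Fin n → SmoothFn n M) :
    ContMDiff 𝓘(ℝ, Model n A) 𝓘(ℝ, Model n A) ∞ (coordMap (A := A) X) :=
  contMDiff_pi_space.2 fun i => contMDiff_pi_space.2 fun j =>
    (prolongFn A (X i)).2 ((Module.finBasis ℝ A).coord j)

/-- The composition of a smooth function on `Aⁿ` with `coordMap X`. -/
noncomputable def compCoordMap (X : Fin n → SmoothFn n M) {g : Model n A → ℝ}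
    (hg : ContDiff ℝ ∞ g) : SmoothFnNear n M A :=
  ⟨fun ξ => g (coordMap X ξ), hg.contMDiff.comp (contMDiff_coordMap X)⟩

theorem derivation_ofReal_const (D : Derivation A (smoothFnA n M A) (smoothFnA n M A)) (r : ℝ) :
    D (ofReal (algebraMap ℝ (SmoothFnNear n M A) r)) = 0 :=
  D.map_algebraMap (algebraMap ℝ A r)

theorem IsVectorField.apply_compCoordMap_eq_zero
    {D : Derivation A (smoothFnA n M A) (smoothFnA n M A)} (hD : IsVectorField D)
    (h0 : ∀ f, D (prolongFn A f) = 0) (X : Fin n → SmoothFn n M) {g : Model n A → ℝ}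
    (hg : ContDiff ℝ ∞ g) : D (ofReal (compCoordMap X hg)) = 0 := by
  -- linear functions of the coordinates are sums of components of the `X i ^ A`
  have hlin : ∀ lam : Model n A →ₗ[ℝ] ℝ, D (ofReal (compCoordMap (M := M) X
      (LinearMap.toContinuousLinearMap lam).contDiff)) = 0 := by
    intro lam
    have h1 : ofReal (compCoordMap (M := M) X (LinearMap.toContinuousLinearMap lam).contDiff) =
        ∑ i, ofReal (component (lam ∘ₗ LinearMap.single ℝ _ i ∘ₗ
          (Module.finBasis ℝ A).equivFun.toLinearMap) (prolongFn A (X i))) := by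
      refine Subtype.ext <| funext fun ξ => ?_
      rw [smoothFnA_sum_apply]
      refine Eq.trans ?_ (map_sum (algebraMap ℝ A) _ _)
      refine congrArg (algebraMap ℝ A) ?_
      change lam (coordMap X ξ) = _
      rw [← LinearMap.sum_single_apply (fun _ : Fin n => Fin (Module.finrank ℝ A) → ℝ)
        (coordMap (A := A) X ξ), map_sum]
      rfl
    rw [h1, map_sum]
    exact Finset.sum_eq_zero fun i _ => hD.apply_component_eq_zero (h0 _) _
  refine Subtype.ext <| funext fun ξ => ?_
  obtain ⟨m, lam, h, hh, hgh⟩ := exists_hadamard_finiteDimensional hg (coordMap X ξ)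
  set c := coordMap X ξ with hc
  have h1 : ofReal (compCoordMap X hg) = ofReal (algebraMap ℝ (SmoothFnNear n M A) (g c)) +
      ∑ k, (ofReal (compCoordMap X (LinearMap.toContinuousLinearMap (lam k)).contDiff) -
        ofReal (algebraMap ℝ (SmoothFnNear n M A) (lam k c))) *
          ofReal (compCoordMap X (hh k)) := by
    refine Subtype.ext <| funext fun η => ?_
    refine Eq.trans ?_ (congrArg (algebraMap ℝ A (g c) + ·) (smoothFnA_sum_apply _ _ η).symm)
    change algebraMap ℝ A (g (coordMap X η)) = _
    rw [hgh, map_add, map_sum]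
    refine congrArg (algebraMap ℝ A (g c) + ·) ?_
    refine Finset.sum_congr rfl fun k _ => ?_
    rw [map_mul, map_sub]
    rfl
  rw [h1, map_add, derivation_ofReal_const, zero_add, map_sum, smoothFnA_sum_apply]
  refine Finset.sum_eq_zero fun k _ => ?_
  rw [D.leibniz, map_sub, hlin, derivation_ofReal_const, sub_zero, smul_zero, add_zero]
  change (algebraMap ℝ A (lam k c) - algebraMap ℝ A (lam k c)) * _ = 0
  rw [sub_self, zero_mul]

/-- A smooth function on `M^A` is, up to a cut-off function pulled back from `M`, a smooth function
of the coordinates, so a vector field which kills every `f^A` vanishes. -/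
theorem IsVectorField.eq_zero
    {D : Derivation A (smoothFnA n M A) (smoothFnA n M A)} (hD : IsVectorField D)
    (h0 : ∀ f, D (prolongFn A f) = 0) : D = 0 := by
  have key : ∀ ψ : SmoothFnNear n M A, D (ofReal ψ) = 0 := by
    intro ψ
    refine Subtype.ext <| funext fun ξ => ?_
    set e := chartAt (EuclideanSpace ℝ (Fin n)) ξ.base with hedef
    have he : e ∈ atlas (EuclideanSpace ℝ (Fin n)) M := chart_mem_atlas _ _
    have hξ : ξ.base ∈ e.source := mem_chart_source _ _
    obtain ⟨X, hX⟩ := NearPoint.exists_coord_extension he hξ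
    have ht : e.target ∈ 𝓝 (e ξ.base) := e.open_target.mem_nhds (e.map_source hξ)
    obtain ⟨b, -, hb⟩ := (SmoothBumpFunction.nhds_basis_tsupport (I := 𝓡 n) (e ξ.base)).mem_iff.1 ht
    -- `ψ` in the chart, cut off so as to be smooth on all of `Aⁿ`
    have hg : ContDiff ℝ ∞ fun w : Model n A =>
        b (center w) * ψ (NearPoint.ofCoord e he w) := by
      rw [← contMDiff_iff_contDiff]
      refine contMDiff_of_tsupport fun w hw => ContDiffAt.contMDiffAt ?_
      have hw' : center w ∈ tsupport b :=
        tsupport_comp_subset_preimage b contDiff_center.continuous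
          (tsupport_smul_subset_left (fun w : Model n A => b (center w)) _ hw)
      exact ((b.contMDiff.contDiff.comp contDiff_center).contDiffAt).mul
        ((NearPoint.contDiffOn_comp_ofCoord he ψ.contMDiff).contDiffAt
          ((NearPoint.isOpen_center_preimage e.open_target).mem_nhds (hb hw')))
    -- `β` is supported where the cut-off `b` is `1` and the `X i` are the coordinates of the chart
    obtain ⟨β, hβ1, hβ0⟩ := exists_bump (n := n) (x := ξ.base)
      (s := {y | y ∈ e.source ∧ b (e y) = 1 ∧ ∀ i, X i =ᶠ[𝓝 y] fun y => e y i}) (by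
        filter_upwards [e.open_source.mem_nhds hξ,
          (e.continuousAt hξ).eventually b.eventuallyEq_one,
          Filter.eventually_all.2 fun i => (hX i).eventuallyEq_nhds] with y h1 h2 h3
        exact ⟨h1, h2, h3⟩)
    set B : SmoothFnNear n M A := component (realPart A).toLinearMap (prolongFn A β) with hB
    have hBη : ∀ η : NearPoint n M A, B η = β η.base := fun η => NearPoint.realPart_toHom η β
    have hDB : D (ofReal B) = 0 := hD.apply_component_eq_zero (h0 β) _
    have h1 : B * ψ = B * compCoordMap X hg := by
      ext η
      change B η * ψ η = B η * (b (center (coordMap X η)) *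
        ψ (NearPoint.ofCoord e he (coordMap X η)))
      rw [hBη]
      by_cases hη : η.base ∈ {y | y ∈ e.source ∧ b (e y) = 1 ∧ ∀ i, X i =ᶠ[𝓝 y] fun y => e y i}
      · have h2 : coordMap X η = NearPoint.chart e he η := by
          rw [← ofVec_toVec (NearPoint.chart e he η)]
          exact congrArg ofVec (funext fun i =>
            (NearPoint.toVec_chart he η i (hη.2.2 i)).symm)
        rw [h2, NearPoint.center_chart he hη.1, NearPoint.ofCoord_chart he hη.1, hη.2.1, one_mul]
      · rw [hβ0 _ hη, zero_mul, zero_mul]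
    -- `D` kills `B`, and `B` is `1` at `ξ`, so multiplication by `B` does not change `D ψ` at `ξ`
    have h2 := congrArg (fun ψ => (D (ofReal ψ)).1 ξ) h1
    simp only [map_mul, D.leibniz, hDB, smul_zero, add_zero,
      hD.apply_compCoordMap_eq_zero h0 X hg] at h2
    have h3 : (ofReal B).1 ξ = 1 := by
      change algebraMap ℝ A (B ξ) = 1
      rw [hBη, hβ1, map_one]
    have h4 : (ofReal B).1 ξ * (D (ofReal ψ)).1 ξ = 0 := h2
    rwa [h3, one_mul] at h4
  refine Derivation.ext fun φ => ?_
  rw [eq_sum_component φ, map_sum]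
  exact Finset.sum_eq_zero fun j _ => by rw [D.map_smul, key, smul_zero]

theorem existsUnique_isProlongation (θ : Derivation ℝ (SmoothFn n M) (SmoothFn n M)) :
    ∃! X : Derivation A (smoothFnA n M A) (smoothFnA n M A), IsProlongation θ X := by
  refine ⟨prolongDerivation θ, isProlongation_prolongDerivation θ, fun X hX => ?_⟩
  have hY := isProlongation_prolongDerivation (A := A) θ
  rw [← sub_eq_zero]
  refine IsVectorField.eq_zero (fun φ hφ ξ => ?_) fun f => ?_
  · obtain ⟨r, hr⟩ := hX.1 φ hφ ξ
    obtain ⟨s, hs⟩ := hY.1 φ hφ ξ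
    refine ⟨r - s, ?_⟩
    rw [map_sub, ← hr, ← hs]
    rfl
  · rw [Derivation.sub_apply, hX.2, hY.2, sub_self]

theorem isProlongation_prolong (θ : Derivation ℝ (SmoothFn n M) (SmoothFn n M)) :
    IsProlongation θ (prolong A θ) :=
  Classical.epsilon_spec (existsUnique_isProlongation θ).exists

/-! ### Globally Hamiltonian vector fields -/

/-- By antisymmetry of the bracket, `[ad(g)]^A(f^A) = {g, f}^A = -{f, g}^A`, so the condition on
`τ_φ` for `φ = f^A` is the one defining `[ad(f)]^A`. -/
theorem PoissonBracket.isTau_prolongFn_iff (P : PoissonBracket n M) (f : SmoothFn n M)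
    (X : Derivation A (smoothFnA n M A) (smoothFnA n M A)) :
    P.IsTau (prolongFn A f) X ↔ IsProlongation (P.ad f) X := by
  have h : ∀ g, -prolong A (P.ad g) (prolongFn A f) = prolongFn A (P.ad f g) := by
    intro g
    have hskew : P.ad f g = -P.ad g f := by
      have h1 := P.bracket_self (f + g)
      simp only [map_add, LinearMap.add_apply, P.bracket_self, zero_add, add_zero] at h1
      exact eq_neg_of_add_eq_zero_right h1
    rw [(isProlongation_prolong (P.ad g)).2 f, hskew]
    exact Subtype.ext <| funext fun ξ => (map_neg ξ.toHom _).symm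
  simp only [PoissonBracket.IsTau, IsProlongation, h]

end Prolongation

end WeilAlgebra

theorem mainTheorem5 (n : ℕ) (M : Type*) [TopologicalSpace M] [T2Space M] [ParacompactSpace M]
    [ChartedSpace (EuclideanSpace ℝ (Fin n)) M] [IsManifold (𝓡 n) ∞ M]
    (A : Type*) [CommRing A] [Algebra ℝ A] [IsWeilAlgebra A]
    (P : WeilAlgebra.PoissonBracket n M) :
    -- every vector field on `M` has exactly one prolongation to `M^A`
    (∀ η : Derivation ℝ (WeilAlgebra.SmoothFn n M) (WeilAlgebra.SmoothFn n M),
      ∃! X : Derivation A (WeilAlgebra.smoothFnA n M A) (WeilAlgebra.smoothFnA n M A),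
        WeilAlgebra.IsProlongation η X) ∧
    ∀ θ : Derivation ℝ (WeilAlgebra.SmoothFn n M) (WeilAlgebra.SmoothFn n M),
      -- if `θ = d_ad(f)`, then `θ^A = [ad(f)]^A` and `θ^A` is the one and only `d_A(f^A)`
      (∀ f : WeilAlgebra.SmoothFn n M, θ = P.dAd f →
        WeilAlgebra.prolong A θ = WeilAlgebra.prolong A (P.ad f) ∧
        (∀ g : WeilAlgebra.SmoothFn n M, WeilAlgebra.prolong A θ (WeilAlgebra.prolongFn A g) =
          WeilAlgebra.prolongFn A (P.bracket f g)) ∧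
        P.IsDifferential (WeilAlgebra.prolongFn A f) (WeilAlgebra.prolong A θ) ∧
        ∀ X : Derivation A (WeilAlgebra.smoothFnA n M A) (WeilAlgebra.smoothFnA n M A),
          P.IsDifferential (WeilAlgebra.prolongFn A f) X → X = WeilAlgebra.prolong A θ) ∧
      -- in particular `θ^A` is globally Hamiltonian if `θ` is
      (P.IsGloballyHamiltonian θ → P.IsGloballyHamiltonianA (WeilAlgebra.prolong A θ)) := by
  refine ⟨WeilAlgebra.existsUnique_isProlongation, fun θ => ?_⟩
  have main : ∀ f : WeilAlgebra.SmoothFn n M, θ = P.dAd f →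
      P.IsDifferential (WeilAlgebra.prolongFn A f) (WeilAlgebra.prolong A θ) := by
    rintro f rfl
    exact ⟨_, (P.isTau_prolongFn_iff f _).2 (WeilAlgebra.isProlongation_prolong (P.ad f)),
      fun _ => rfl⟩
  refine ⟨?_, fun ⟨f, hf⟩ => ⟨_, main f hf⟩⟩
  intro f hf
  refine ⟨congrArg _ hf, fun g => ?_, main f hf, ?_⟩
  · subst hf
    exact (WeilAlgebra.isProlongation_prolong (P.ad f)).2 g
  · rintro X ⟨Y, hY, hXY⟩
    subst hf
    have hXY' : X = Y := Derivation.ext hXY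
    rw [hXY']
    exact (WeilAlgebra.existsUnique_isProlongation (P.ad f)).unique
      ((P.isTau_prolongFn_iff f Y).1 hY) (WeilAlgebra.isProlongation_prolong (P.ad f))
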